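/- Let $\mathcal V$ be a symmetric monoidal category, with monoidal product $\otimes$, unit $I$ and symmetry $\sigma$. A *semi-Hopf $\mathcal V$-category* $A$ is a category with a (small) set of objects $A^0$ enriched in the monoidal category of coalgebras in $\mathcal V$. Explicitly, it is a $\mathcal V$-category with Hom-objects $A_{xy}$, compositions $m_{xyz}\colon A_{xy}\otimes A_{yz}\to A_{xz}$ and units $j_x\colon I\to A_{xx}$, in which every $A_{xy}$ is a coassociative counital coalgebra $(A_{xy},\delta_{xy},\epsilon_{xy})$ in $\mathcal V$ and all $m_{xyz}$ and $j_x$ are coalgebra morphisms. With the $\mathcal V$-functors all of whose components are coalgebra morphisms, semi-Hopf $\mathcal V$-categories form a category $\mathcal V\text{-}\mathsf{sHopf}$. An *antipode* for $A$ is a family of morphisms $S_{xy}\colon A_{xy}\to A_{yx}$ in $\mathcal V$ with $$m_{xyx}\circ(\mathrm{id}\otimes S_{xy})\circ\delta_{xy}=j_x\circ\epsilon_{xy},\qquad m_{yxy}\circ(S_{xy}\otimes \mathrm{id})\circ\delta_{xy}=j_y\circ\epsilon_{xy}\qquad\text{for all }x,y\in A^0 .$$ Let $\mathcal V\text{-}\mathsf{Hopf}$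 be the full subcategory of $\mathcal V\text{-}\mathsf{sHopf}$ on the semi-Hopf $\mathcal V$-categories that admit an antipode (the Hopf $\mathcal V$-categories). The monoidal product of $\mathcal V$ is *very flat* if for every object $A$ and every nonempty jointly monic family $(\beta_i\colon B\to B_i)_{i\in\mathcal I}$ in $\mathcal V$ the family $(\beta_i\otimes\mathrm{id}_A\colon B\otimes A\to B_i\otimes A)_{i\in\mathcal I}$ is jointly monic. **Proposition.** Let $\mathcal V$ be a symmetric monoidal and locally presentable category. 1. If $\mathcal V$ is monoidal closed, then $\mathcal V\text{-}\mathsf{Hopf}$ is a cocomplete full subcategory of $\mathcal V\text{-}\mathsf{sHopf}$: it has all small colimits, the inclusion into $\mathcal V\text{-}\mathsf{sHopf}$ preserves them, and $\mathcal V\text{-}\mathsf{Hopf}$ is closed under small colimits in $\mathcal V\text{-}\mathsf{sHopf}$, that is, every colimit in $\mathcal V\text{-}\mathsf{sHopf}$ of a small diagram of Hopf $\mathcal V$-categories is a Hopf $\mathcal V$-category. 2. If the monoidal product of $\mathcal V$ is very flat, then $\mathcal V\text{-}\mathsf{Hopf}$ is a complete full subcategory of $\mathcal V\text{-}\mathsf{sHopf}$: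 it has all small limits, the inclusion into $\mathcal V\text{-}\mathsf{sHopf}$ preserves them, and $\mathcal V\text{-}\mathsf{Hopf}$ is closed under small limits in $\mathcal V\text{-}\mathsf{sHopf}$, that is, every limit in $\mathcal V\text{-}\mathsf{sHopf}$ of a small diagram of Hopf $\mathcal V$-categories is a Hopf $\mathcal V$-category. -/

import Mathlib

open CategoryTheory MonoidalCategory Limits
open scoped ComonObj

universe v u

/-- A family of morphisms with common domain `B` is jointly monic if two parallel morphisms into
`B` are equal as soon as they become equal after composition with every member of the family. -/
def JointlyMonic {V : Type u} [Category.{v} V] {B : V} {ι : Type v} {X : ι → V}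
    (β : ∀ i, B ⟶ X i) : Prop :=
  ∀ ⦃W : V⦄ (g h : W ⟶ B), (∀ i, g ≫ β i = h ≫ β i) → g = h

/-- The monoidal product of `V` is very flat: for every object `A`, the functor `- ⊗ A` preserves
(nonempty) jointly monic families. Empty families are left out: in the category of sets the empty
family on the singleton is jointly monic, but the empty family on `{*} × A` in general is not,
although the cartesian product of sets is to be very flat. -/
def VeryFlatTensor (V : Type u) [Category.{v} V] [MonoidalCategory V] : Prop :=
  ∀ (A B : V) (ι : Type v) [Nonempty ι] (X : ι → V) (β : ∀ i, B ⟶ X i),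
    JointlyMonic β → JointlyMonic (fun i => β i ▷ A)

/-- A semi-Hopf `V`-category over a symmetric (or braided) monoidal category `V`: a `V`-category
with a set of objects, all of whose Hom-objects are coalgebras in `V`, such that the compositions
`A x y ⊗ A y z ⟶ A x z` and units `𝟙_ V ⟶ A x x` are morphisms of coalgebras. -/
structure SemiHopfCat (V : Type u) [Category.{v} V] [MonoidalCategory V] [BraidedCategory V] where
  /-- The set of objects. -/
  carrier : Type v
  /-- The `V`-category structure. -/
  [enriched : EnrichedCategory V carrier]
  /-- The coalgebra structure of each Hom-object. -/
  [comon : ∀ x y : carrier, ComonObj (x ⟶[V] y)]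
  comp_comul : ∀ x y z : carrier,
    eComp V x y z ≫ Δ[x ⟶[V] z] =
      (Δ[x ⟶[V] y] ⊗ₘ Δ[y ⟶[V] z]) ≫
        tensorμ (x ⟶[V] y) (x ⟶[V] y) (y ⟶[V] z) (y ⟶[V] z) ≫
          (eComp V x y z ⊗ₘ eComp V x y z)
  comp_counit : ∀ x y z : carrier,
    eComp V x y z ≫ ε[x ⟶[V] z] = (ε[x ⟶[V] y] ⊗ₘ ε[y ⟶[V] z]) ≫ (λ_ (𝟙_ V)).hom
  id_comul : ∀ x : carrier,
    eId V x ≫ Δ[x ⟶[V] x] = (λ_ (𝟙_ V)).inv ≫ (eId V x ⊗ₘ eId V x)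
  id_counit : ∀ x : carrier, eId V x ≫ ε[x ⟶[V] x] = 𝟙 (𝟙_ V)

namespace SemiHopfCat

attribute [instance] enriched comon

variable {V : Type u} [Category.{v} V] [MonoidalCategory V] [BraidedCategory V]

/-- A semi-Hopf `V`-functor: a `V`-functor whose components are morphisms of coalgebras. -/
structure Hom (A B : SemiHopfCat V) where
  /-- The underlying `V`-functor. -/
  toFunctor : EnrichedFunctor V A.carrier B.carrier
  isComonHom : ∀ x y : A.carrier, IsComonHom (toFunctor.map x y)

attribute [instance] Hom.isComonHom

theorem Hom.ext_toFunctor {A B : SemiHopfCat V} {f g : Hom A B}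
    (h : f.toFunctor = g.toFunctor) : f = g := by
  cases f; cases g; cases h; rfl

/-- The category `V`-sHopf of semi-Hopf `V`-categories and semi-Hopf `V`-functors. -/
instance : Category.{v} (SemiHopfCat V) where
  Hom A B := Hom A B
  id A :=
    { toFunctor := EnrichedFunctor.id V A.carrier
      isComonHom := fun x y => inferInstanceAs (IsComonHom (𝟙 (x ⟶[V] y))) }
  comp f g :=
    { toFunctor := f.toFunctor.comp V g.toFunctor
      isComonHom := fun x y => inferInstanceAs
        (IsComonHom (f.toFunctor.map x y ≫ g.toFunctor.map _ _)) }
  id_comp _ := Hom.ext_toFunctor (EnrichedFunctor.ext V (fun _ => rfl)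
    (fun _ _ => (Category.comp_id _).trans (Category.id_comp _)))
  comp_id _ := Hom.ext_toFunctor (EnrichedFunctor.ext V (fun _ => rfl)
    (fun _ _ => (Category.comp_id _).trans (Category.comp_id _)))
  assoc _ _ _ := Hom.ext_toFunctor (EnrichedFunctor.ext V (fun _ => rfl)
    (fun _ _ => (Category.comp_id _).trans (Category.assoc _ _ _)))

/-- `S` is an antipode for the semi-Hopf `V`-category `A`. -/
def IsAntipode (A : SemiHopfCat V) (S : ∀ x y : A.carrier, (x ⟶[V] y) ⟶ (y ⟶[V] x)) : Prop :=
  ∀ x y : A.carrier,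
    Δ[x ⟶[V] y] ≫ ((x ⟶[V] y) ◁ S x y) ≫ eComp V x y x = ε[x ⟶[V] y] ≫ eId V x ∧
    Δ[x ⟶[V] y] ≫ (S x y ▷ (x ⟶[V] y)) ≫ eComp V y x y = ε[x ⟶[V] y] ≫ eId V y

end SemiHopfCat

/-- The property of semi-Hopf `V`-categories of being Hopf, that is, of admitting an antipode. -/
def isHopf (V : Type u) [Category.{v} V] [MonoidalCategory V] [BraidedCategory V] :
    ObjectProperty (SemiHopfCat V) :=
  fun A => ∃ S : ∀ x y : A.carrier, (x ⟶[V] y) ⟶ (y ⟶[V] x), A.IsAntipode S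

/-- The category `V`-Hopf: the full subcategory of `V`-sHopf on the Hopf `V`-categories. -/
abbrev HopfCat (V : Type u) [Category.{v} V] [MonoidalCategory V] [BraidedCategory V] :=
  (isHopf V).FullSubcategory

universe w w'

/-
Antipodes are convolution inverses of identities. Convolution inverses are unique, so antipodes
reverse compositions and comultiplications and commute with semi-Hopf functors.

A Hom-object of a colimit is the colimit, computed in `V`, of the tensor products of Hom-objects
along words of composable letters. The antipodes of the members of the diagram form a cocone with
values in the opposite of this `V`-category, and the morphism which it induces is a convolution
inverse of the identity because it is one on every word.

A Hom-object of a limit is a limit of comonoids. When tensoring is very flat, such a limit exists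
and its projections followed by the iterated comultiplications are jointly monic: a comonoid with a
cone can be replaced by its image in the product of all tensor words in the target, and there is
only a set of such images. The antipodes induce a morphism from the co-opposite of the limit. It
satisfies the antipode equations because, although `id * S` is not a comonoid morphism, the
comultiplication of `id * S` reads `x₁ S(x₄) ⊗ x₂ S(x₃)` and collapses from the inside.
-/

section LocallyPresentable

variable (V : Type u) [Category.{v} V] [IsLocallyPresentable.{v} V]

theorem hasColimits_of_isLocallyPresentable : HasColimits V := by
  obtain ⟨κ, _, _⟩ := IsLocallyPresentable.exists_cardinal.{v} V
  infer_instance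

-- `V` is reflective in the presheaves on a small dense subcategory of presentable objects.
theorem hasLimits_of_isLocallyPresentable : HasLimits V := by
  have := hasColimits_of_isLocallyPresentable V
  obtain ⟨κ, _, _⟩ := IsLocallyPresentable.exists_cardinal.{v} V
  let P := isCardinalPresentable V κ
  let A : SmallModel.{v} P.FullSubcategory ⥤ V :=
    (equivSmallModel.{v} P.FullSubcategory).inverse ⋙ P.ι
  have : A.IsDense := inferInstance
  let : Reflective (Presheaf.restrictedULiftYoneda.{v} A) :=
    { L := uliftYoneda.{v}.leftKanExtension A
      adj := Presheaf.uliftYonedaAdjunction.{v} _ (uliftYoneda.{v}.leftKanExtensionUnit A) }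
  exact hasLimits_of_reflective (Presheaf.restrictedULiftYoneda.{v} A)

theorem wellPowered_of_isLocallyPresentable : WellPowered.{v} V := by
  have := hasLimits_of_isLocallyPresentable V
  have := hasColimits_of_isLocallyPresentable V
  obtain ⟨κ, _, _⟩ := IsLocallyPresentable.exists_cardinal.{v} V
  obtain ⟨P, _, hP, -⟩ :=
    (IsCardinalLocallyPresentable.iff_exists_isStrongGenerator V κ).1 inferInstance
  have isDetecting : P.IsDetecting := fun X Y f hf => by
    have : Mono f := (hP.isSeparating.mono_iff f).2 fun G hG g h hgh =>
      (hf G hG (g ≫ f)).unique rfl hgh.symm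
    exact hP.isIso_of_mono f fun G hG g => (hf G hG g).exists
  exact wellPowered_of_isDetecting isDetecting

end LocallyPresentable

section Factorization

variable {V : Type u} [Category.{v} V] [HasLimits V] [WellPowered.{v} V]

theorem factors_sInf {X Y : V} {s : Set (Subobject Y)} {f : X ⟶ Y} (hf : ∀ S ∈ s, S.Factors f) :
    (Subobject.sInf.{v} s).Factors f := by
  have mem : ∀ k ∈ equivShrink.{v} (Subobject Y) '' s,
      ((equivShrink.{v} (Subobject Y)).symm k).Factors f := by
    rintro _ ⟨S, hS, rfl⟩
    simpa only [Equiv.symm_apply_apply] using hf S hS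
  let c : Cone (Subobject.wideCospan.{v} s) := WidePullbackShape.mkCone f
    (fun k => Subobject.factorThru _ f (mem k.1 k.2)) fun k => Subobject.factorThru_arrow _ f _
  exact (Subobject.mk_factors_iff _ f).2 ⟨limit.lift _ c, limit.lift_π c none⟩

-- `E` is the smallest subobject of the codomain through which the morphism factors.
instance hasStrongEpiMonoFactorisations_of_wellPowered : HasStrongEpiMonoFactorisations V :=
  .mk fun {X Y} f => by
    let E : Subobject Y := Subobject.sInf.{v} {S | S.Factors f}
    have hE : E.Factors f := factors_sInf fun _ h => h
    have : ExtremalEpi (E.factorThru f hE) := .mk_of_hasEqualizers _ fun Z p i fac _ => by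
      have fac' : p ≫ i ≫ E.arrow = f := by
        rw [reassoc_of% fac, Subobject.factorThru_arrow]
      have hZ : E ≤ Subobject.mk (i ≫ E.arrow) := Subobject.sInf_le.{v} _ _
        ((Subobject.mk_factors_iff _ _).2 ⟨p, fac'⟩)
      have retraction : E.ofLEMk _ hZ ≫ i = 𝟙 _ := by
        rw [← cancel_mono E.arrow, Category.assoc, Subobject.ofLEMk_comp, Category.id_comp]
      exact ⟨_, by rw [← cancel_mono i, Category.assoc, retraction, Category.comp_id,
        Category.id_comp], retraction⟩
    exact
      { I := E
        m := E.arrow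
        m_mono := inferInstance
        e := E.factorThru f hE
        fac := E.factorThru_arrow f hE
        e_strong_epi := (extremalEpi_iff_strongEpi_of_hasPullbacks _).1 this }

end Factorization

section ComonColimits

variable {V : Type u} [Category.{v} V] [MonoidalCategory V] {J : Type w} [Category.{w'} J]
  [HasColimitsOfShape J V]

instance : HasColimitsOfShape J (Comon V) :=
  have : HasColimitsOfShape Jᵒᵖᵒᵖ V :=
    hasColimitsOfShape_of_equivalence (opOpEquivalence J).symm
  have : HasLimitsOfShape Jᵒᵖ Vᵒᵖ := hasLimitsOfShape_op_of_hasColimitsOfShape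
  have : HasColimitsOfShape J (Mon Vᵒᵖ)ᵒᵖ := hasColimitsOfShape_op_of_hasLimitsOfShape
  Adjunction.hasColimitsOfShape_of_equivalence (Comon.Comon_EquivMon_OpOp V).functor

instance : PreservesColimitsOfShape J (Comon.forget V) :=
  have : HasColimitsOfShape Jᵒᵖᵒᵖ V :=
    hasColimitsOfShape_of_equivalence (opOpEquivalence J).symm
  have : HasLimitsOfShape Jᵒᵖ Vᵒᵖ := hasLimitsOfShape_op_of_hasColimitsOfShape
  have : PreservesColimitsOfShape J (Mon.forget Vᵒᵖ).op :=
    preservesColimitsOfShape_op J (Mon.forget Vᵒᵖ)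
  preservesColimitsOfShape_of_natIso
    (show (Comon.Comon_EquivMon_OpOp V).functor ⋙ (Mon.forget Vᵒᵖ).op ⋙ unopUnop V ≅ Comon.forget V
      from Iso.refl _)

end ComonColimits

/-! ### Comonoids and convolution -/

section ComonoidTensor

variable {V : Type u} [Category.{v} V] [MonoidalCategory V] [BraidedCategory V]

instance tensorHom_isComonHom {C D C' D' : V} [ComonObj C] [ComonObj D] [ComonObj C'] [ComonObj D']
    (f : C ⟶ C') (g : D ⟶ D') [IsComonHom f] [IsComonHom g] : IsComonHom (f ⊗ₘ g) :=
  (MonoidalCategory.tensorHom (C := Comon V) (X₁ := ⟨C⟩) (Y₁ := ⟨C'⟩) (X₂ := ⟨D⟩) (Y₂ := ⟨D'⟩)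
    (Comon.Hom.mk f) (Comon.Hom.mk g)).isComonHom_hom

instance whiskerRight_isComonHom {C C' : V} [ComonObj C] [ComonObj C']
    (f : C ⟶ C') (D : V) [ComonObj D] [IsComonHom f] : IsComonHom (f ▷ D) := by
  rw [← tensorHom_id]; infer_instance

instance whiskerLeft_isComonHom {D D' : V} (C : V) [ComonObj C] [ComonObj D] [ComonObj D']
    (g : D ⟶ D') [IsComonHom g] : IsComonHom (C ◁ g) := by
  rw [← id_tensorHom]; infer_instance

instance associator_hom_isComonHom (C D E : V) [ComonObj C] [ComonObj D] [ComonObj E] :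
    IsComonHom (α_ C D E).hom := by
  have h : (α_ (Comon.mk C) (Comon.mk D) (Comon.mk E)).hom.hom = (α_ C D E).hom :=
    (Comon.monoidal_associator_hom_hom V (Comon.mk C) (Comon.mk D) (Comon.mk E)).trans (by
      change 𝟙 (C ⊗ D) ▷ E ≫ _ ≫ C ◁ 𝟙 (D ⊗ E) = _
      rw [id_whiskerRight, MonoidalCategory.whiskerLeft_id, Category.comp_id, Category.id_comp])
  exact h ▸ (α_ (Comon.mk C) (Comon.mk D) (Comon.mk E)).hom.isComonHom_hom

attribute [local instance] ComonObj.instTensorUnit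

instance leftUnitor_hom_isComonHom (C : V) [ComonObj C] : IsComonHom (λ_ C).hom := by
  have h : (λ_ (Comon.mk C)).hom.hom = (λ_ C).hom :=
    (Comon.monoidal_leftUnitor_hom_hom V (Comon.mk C)).trans (by
      change 𝟙 (𝟙_ V) ▷ C ≫ _ = _
      rw [id_whiskerRight, Category.id_comp])
  exact h ▸ (λ_ (Comon.mk C)).hom.isComonHom_hom

instance rightUnitor_hom_isComonHom (C : V) [ComonObj C] : IsComonHom (ρ_ C).hom := by
  have h : (ρ_ (Comon.mk C)).hom.hom = (ρ_ C).hom :=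
    (Comon.monoidal_rightUnitor_hom_hom V (Comon.mk C)).trans (by
      change C ◁ 𝟙 (𝟙_ V) ≫ _ = _
      rw [MonoidalCategory.whiskerLeft_id, Category.id_comp])
  exact h ▸ (ρ_ (Comon.mk C)).hom.isComonHom_hom

instance counit_isComonHom (C : V) [ComonObj C] : IsComonHom ε[C] :=
  (Comon.uniqueHomToTrivial (Comon.mk C)).default.isComonHom_hom

variable (C D : V) [ComonObj C] [ComonObj D]

/-- The first projection of a tensor product of comonoids. -/
def tensorFst : C ⊗ D ⟶ C := C ◁ ε[D] ≫ (ρ_ C).hom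

/-- The second projection of a tensor product of comonoids. -/
def tensorSnd : C ⊗ D ⟶ D := ε[C] ▷ D ≫ (λ_ D).hom

instance : IsComonHom (tensorFst C D) :=
  inferInstanceAs (IsComonHom (C ◁ ε[D] ≫ (ρ_ C).hom))

instance : IsComonHom (tensorSnd C D) :=
  inferInstanceAs (IsComonHom (ε[C] ▷ D ≫ (λ_ D).hom))

theorem comul_fst_snd : Δ[C ⊗ D] ≫ (tensorFst C D ⊗ₘ tensorSnd C D) = 𝟙 (C ⊗ D) := by
  have h : tensorFst C D ⊗ₘ tensorSnd C D =
      ((𝟙 C ⊗ₘ ε[D]) ⊗ₘ (ε[C] ⊗ₘ 𝟙 D)) ≫ ((ρ_ C).hom ⊗ₘ (λ_ D).hom) := by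
    simp [tensorFst, tensorSnd]
  rw [h, Comon.tensorObj_comul, Category.assoc, ← tensorμ_natural_assoc,
    tensorHom_comp_tensorHom_assoc]
  simp only [ComonObj.comul_counit_hom, ComonObj.counit_comul_hom, Category.id_comp]
  have : (β_ (𝟙_ V) (𝟙_ V)).hom = 𝟙 _ := by
    rw [braiding_tensorUnit_left, ← unitors_inv_equal, Iso.hom_inv_id]
  rw [tensorμ, this]
  monoidal

theorem comul_snd_fst : Δ[C ⊗ D] ≫ (tensorSnd C D ⊗ₘ tensorFst C D) = (β_ C D).hom := by
  have h : tensorSnd C D ⊗ₘ tensorFst C D =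
      ((ε[C] ⊗ₘ 𝟙 D) ⊗ₘ (𝟙 C ⊗ₘ ε[D])) ≫ ((λ_ D).hom ⊗ₘ (ρ_ C).hom) := by
    simp [tensorFst, tensorSnd]
  rw [h, Comon.tensorObj_comul, Category.assoc, ← tensorμ_natural_assoc,
    tensorHom_comp_tensorHom_assoc]
  simp only [ComonObj.comul_counit_hom, ComonObj.counit_comul_hom, Category.id_comp]
  simp only [tensorμ, Category.assoc]
  monoidal

end ComonoidTensor

section Convolution

variable {V : Type u} [Category.{v} V] [MonoidalCategory V]

/-- The convolution of two morphisms from a comonoid to composable Hom-objects of a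
`V`-category. -/
def conv {C : V} [ComonObj C] {B : Type w} [EnrichedCategory V B] {x y z : B}
    (f : C ⟶ (x ⟶[V] y)) (g : C ⟶ (y ⟶[V] z)) : C ⟶ (x ⟶[V] z) :=
  Δ[C] ≫ (f ⊗ₘ g) ≫ eComp V x y z

/-- The identities for convolution. -/
def convUnit (C : V) [ComonObj C] {B : Type w} [EnrichedCategory V B] (x : B) :
    C ⟶ (x ⟶[V] x) :=
  ε[C] ≫ eId V x

section

variable {C : V} [ComonObj C] {B : Type w} [EnrichedCategory V B]

theorem convUnit_conv {x y : B} (f : C ⟶ (x ⟶[V] y)) : conv (convUnit C x) f = f := by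
  have : convUnit C x ⊗ₘ f = (ε[C] ⊗ₘ f) ≫ eId V x ▷ _ := by
    rw [convUnit, ← tensorHom_id, tensorHom_comp_tensorHom, Category.comp_id]
  rw [conv, this]
  simp

theorem conv_convUnit {x y : B} (f : C ⟶ (x ⟶[V] y)) : conv f (convUnit C y) = f := by
  have : f ⊗ₘ convUnit C y = (f ⊗ₘ ε[C]) ≫ _ ◁ eId V y := by
    rw [convUnit, ← id_tensorHom, tensorHom_comp_tensorHom, Category.comp_id]
  rw [conv, this]
  simp

theorem conv_assoc {x y z t : B} (f : C ⟶ (x ⟶[V] y)) (g : C ⟶ (y ⟶[V] z))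
    (h : C ⟶ (z ⟶[V] t)) : conv (conv f g) h = conv f (conv g h) := by
  have h₁ : conv f g ⊗ₘ h = Δ[C] ▷ C ≫ ((f ⊗ₘ g) ⊗ₘ h) ≫ eComp V x y z ▷ _ := by
    simp only [conv, ← tensorHom_id, tensorHom_comp_tensorHom, Category.id_comp,
      Category.comp_id]
  have h₂ : f ⊗ₘ conv g h = C ◁ Δ[C] ≫ (f ⊗ₘ (g ⊗ₘ h)) ≫ _ ◁ eComp V y z t := by
    simp only [conv, ← id_tensorHom, tensorHom_comp_tensorHom, Category.id_comp,
      Category.comp_id]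
  rw [conv, h₁]
  conv_rhs => rw [conv, h₂]
  simp only [Category.assoc, ← e_assoc, ComonObj.comul_assoc_assoc]
  simp

theorem comp_conv {D : V} [ComonObj D] (φ : D ⟶ C) [IsComonHom φ] {x y z : B}
    (f : C ⟶ (x ⟶[V] y)) (g : C ⟶ (y ⟶[V] z)) : φ ≫ conv f g = conv (φ ≫ f) (φ ≫ g) := by
  simp [conv]

theorem comp_convUnit {D : V} [ComonObj D] (φ : D ⟶ C) [IsComonHom φ] (x : B) :
    φ ≫ convUnit C x = convUnit D x := by
  simp [convUnit]

theorem conv_map {B' : Type w'} [EnrichedCategory V B'] (F : EnrichedFunctor V B B') {x y z : B}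
    (f : C ⟶ (x ⟶[V] y)) (g : C ⟶ (y ⟶[V] z)) :
    conv f g ≫ F.map x z = conv (f ≫ F.map x y) (g ≫ F.map y z) := by
  simp [conv]

theorem convUnit_map {B' : Type w'} [EnrichedCategory V B'] (F : EnrichedFunctor V B B') (x : B) :
    convUnit C x ≫ F.map x x = convUnit C (F.obj x) := by
  simp [convUnit]

/-- Two morphisms from a comonoid to opposite Hom-objects of a `V`-category are convolution
inverses of each other. -/
structure IsConvInverse {x y : B} (f : C ⟶ (x ⟶[V] y)) (g : C ⟶ (y ⟶[V] x)) : Prop where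
  right : conv f g = convUnit C x
  left : conv g f = convUnit C y

namespace IsConvInverse

theorem unique {x y : B} {f : C ⟶ (x ⟶[V] y)} {g h : C ⟶ (y ⟶[V] x)}
    (hg : IsConvInverse f g) (hh : IsConvInverse f h) : g = h := by
  rw [← conv_convUnit g, ← hh.right, ← conv_assoc, hg.left, convUnit_conv]

theorem convUnit (x : B) : IsConvInverse (convUnit C x) (convUnit C x) :=
  ⟨convUnit_conv _, convUnit_conv _⟩

theorem comp {D : V} [ComonObj D] (φ : D ⟶ C) [IsComonHom φ] {x y : B} {f : C ⟶ (x ⟶[V] y)}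
    {g : C ⟶ (y ⟶[V] x)} (h : IsConvInverse f g) : IsConvInverse (φ ≫ f) (φ ≫ g) :=
  ⟨by rw [← comp_conv, h.right, comp_convUnit], by rw [← comp_conv, h.left, comp_convUnit]⟩

theorem map {B' : Type w'} [EnrichedCategory V B'] (F : EnrichedFunctor V B B') {x y : B}
    {f : C ⟶ (x ⟶[V] y)} {g : C ⟶ (y ⟶[V] x)} (h : IsConvInverse f g) :
    IsConvInverse (f ≫ F.map x y) (g ≫ F.map y x) :=
  ⟨by rw [← conv_map, h.right, convUnit_map], by rw [← conv_map, h.left, convUnit_map]⟩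

theorem conv {x y z : B} {f : C ⟶ (x ⟶[V] y)} {f' : C ⟶ (y ⟶[V] x)} {g : C ⟶ (y ⟶[V] z)}
    {g' : C ⟶ (z ⟶[V] y)} (hf : IsConvInverse f f') (hg : IsConvInverse g g') :
    IsConvInverse (conv f g) (conv g' f') :=
  ⟨by rw [conv_assoc, ← conv_assoc g, hg.right, convUnit_conv, hf.right],
    by rw [conv_assoc, ← conv_assoc f', hf.left, convUnit_conv, hg.left]⟩

end IsConvInverse

end

section Braided

variable [BraidedCategory V] {C D : V} [ComonObj C] [ComonObj D]
  {B : Type w} [EnrichedCategory V B] {x y z : B}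

theorem conv_fst_snd (f : C ⟶ (x ⟶[V] y)) (g : D ⟶ (y ⟶[V] z)) :
    conv (tensorFst C D ≫ f) (tensorSnd C D ≫ g) = (f ⊗ₘ g) ≫ eComp V x y z := by
  rw [conv, ← tensorHom_comp_tensorHom, Category.assoc, reassoc_of% @comul_fst_snd]

theorem conv_snd_fst (g : D ⟶ (x ⟶[V] y)) (f : C ⟶ (y ⟶[V] z)) :
    conv (tensorSnd C D ≫ g) (tensorFst C D ≫ f) =
      (β_ C D).hom ≫ (g ⊗ₘ f) ≫ eComp V x y z := by
  rw [conv, ← tensorHom_comp_tensorHom, Category.assoc, reassoc_of% @comul_snd_fst]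

theorem IsConvInverse.tensorHom_comp_eComp {f : C ⟶ (x ⟶[V] y)} {f' : C ⟶ (y ⟶[V] x)}
    {g : D ⟶ (y ⟶[V] z)} {g' : D ⟶ (z ⟶[V] y)} (hf : IsConvInverse f f')
    (hg : IsConvInverse g g') :
    IsConvInverse ((f ⊗ₘ g) ≫ eComp V x y z) ((β_ C D).hom ≫ (g' ⊗ₘ f') ≫ eComp V z y x) := by
  rw [← conv_fst_snd, ← conv_snd_fst]
  exact (hf.comp _).conv (hg.comp _)

end Braided

end Convolution

namespace SemiHopfCat

variable {V : Type u} [Category.{v} V] [MonoidalCategory V] [BraidedCategory V]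

/-- The action of a semi-Hopf functor on objects. -/
def onObj {A B : SemiHopfCat V} (F : A ⟶ B) : A.carrier → B.carrier :=
  (show Hom A B from F).toFunctor.obj

/-- The component of a semi-Hopf functor at `x` and `y`, with its codomain transported along
equalities of objects. -/
def onHom {A B : SemiHopfCat V} (F : A ⟶ B) {x y : A.carrier} {x' y' : B.carrier}
    (hx : onObj F x = x') (hy : onObj F y = y') : (x ⟶[V] y) ⟶ (x' ⟶[V] y') :=
  (show Hom A B from F).toFunctor.map x y ≫ eqToHom (by rw [← hx, ← hy]; rfl)

theorem onHom_rfl {A B : SemiHopfCat V} (F : A ⟶ B) (x y : A.carrier) :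
    onHom F (rfl : onObj F x = _) (rfl : onObj F y = _) =
      (show Hom A B from F).toFunctor.map x y :=
  Category.comp_id _

instance onHom_isComonHom {A B : SemiHopfCat V} (F : A ⟶ B) {x y : A.carrier} {x' y' : B.carrier}
    (hx : onObj F x = x') (hy : onObj F y = y') : IsComonHom (onHom F hx hy) := by
  subst hx hy
  rw [onHom_rfl]
  exact (show Hom A B from F).isComonHom x y

theorem onHom_id {A B : SemiHopfCat V} (F : A ⟶ B) {x : A.carrier} {x' : B.carrier}
    (hx hx₁ : onObj F x = x') : eId V x ≫ onHom F hx hx₁ = eId V x' := by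
  subst hx
  rw [onHom_rfl]
  exact (show Hom A B from F).toFunctor.map_id x

theorem onHom_comp {A B : SemiHopfCat V} (F : A ⟶ B) {x y z : A.carrier} {x' y' z' : B.carrier}
    (hx : onObj F x = x') (hy : onObj F y = y') (hz : onObj F z = z') :
    eComp V x y z ≫ onHom F hx hz = (onHom F hx hy ⊗ₘ onHom F hy hz) ≫ eComp V x' y' z' := by
  subst hx hy hz
  rw [onHom_rfl, onHom_rfl, onHom_rfl]
  exact (show Hom A B from F).toFunctor.map_comp x y z

theorem onHom_onHom {A B C : SemiHopfCat V} (F : A ⟶ B) (G : B ⟶ C) {x y : A.carrier}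
    {x' y' : B.carrier} {x'' y'' : C.carrier}
    (hx : onObj F x = x') (hy : onObj F y = y') (hx' : onObj G x' = x'')
    (hy' : onObj G y' = y'') :
    onHom F hx hy ≫ onHom G hx' hy' =
      onHom (F ≫ G) ((congrArg (onObj G) hx).trans hx') ((congrArg (onObj G) hy).trans hy') := by
  subst hx hy hx' hy'
  rw [onHom_rfl, onHom_rfl]
  exact (onHom_rfl (F ≫ G) x y).symm

theorem onHom_congr {A B : SemiHopfCat V} {F G : A ⟶ B} (h : F = G) {x y : A.carrier}
    {x' y' : B.carrier} (hx : onObj F x = x') (hy : onObj F y = y') :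
    onHom F hx hy = onHom G (h ▸ hx) (h ▸ hy) := by
  subst h; rfl

theorem onHom_id_functor {A : SemiHopfCat V} (x y : A.carrier)
    (hx : onObj (𝟙 A) x = x) (hy : onObj (𝟙 A) y = y) : onHom (𝟙 A) hx hy = 𝟙 (x ⟶[V] y) :=
  onHom_rfl (𝟙 A) x y

theorem hom_ext {A B : SemiHopfCat V} {F G : A ⟶ B} (h : ∀ x, onObj F x = onObj G x)
    (h' : ∀ x y, onHom F (h x) (h y) = onHom G rfl rfl) : F = G :=
  Hom.ext_toFunctor (EnrichedFunctor.ext V h fun x y => (h' x y).trans (onHom_rfl G x y))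

theorem conv_onHom {A B : SemiHopfCat V} (F : A ⟶ B) {C : V} [ComonObj C] {x y z : A.carrier}
    {x' y' z' : B.carrier} (hx : onObj F x = x') (hy : onObj F y = y') (hz : onObj F z = z')
    (f : C ⟶ (x ⟶[V] y)) (g : C ⟶ (y ⟶[V] z)) :
    conv f g ≫ onHom F hx hz = conv (f ≫ onHom F hx hy) (g ≫ onHom F hy hz) := by
  simp only [conv, Category.assoc, onHom_comp F hx hy hz, tensorHom_comp_tensorHom_assoc]

theorem convUnit_onHom {A B : SemiHopfCat V} (F : A ⟶ B) (C : V) [ComonObj C] {x : A.carrier}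
    {x' : B.carrier} (hx hx₁ : onObj F x = x') :
    convUnit C x ≫ onHom F hx hx₁ = convUnit C x' := by
  rw [convUnit, Category.assoc, onHom_id, convUnit]

theorem _root_.IsConvInverse.onHom {A B : SemiHopfCat V} (F : A ⟶ B) {C : V} [ComonObj C]
    {x y : A.carrier} {x' y' : B.carrier} (hx : onObj F x = x') (hy : onObj F y = y')
    {f : C ⟶ (x ⟶[V] y)} {g : C ⟶ (y ⟶[V] x)} (h : IsConvInverse f g) :
    IsConvInverse (f ≫ onHom F hx hy) (g ≫ onHom F hy hx) :=
  ⟨by rw [← conv_onHom F hx hy hx, h.right, convUnit_onHom],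
    by rw [← conv_onHom F hy hx hy, h.left, convUnit_onHom]⟩

section

attribute [local instance] ComonObj.instTensorUnit

instance eComp_isComonHom (A : SemiHopfCat V) (x y z : A.carrier) : IsComonHom (eComp V x y z) where
  hom_counit := A.comp_counit x y z
  hom_comul := by
    rw [A.comp_comul x y z, Comon.tensorObj_comul, Category.assoc]

instance eId_isComonHom (A : SemiHopfCat V) (x : A.carrier) : IsComonHom (eId V x) where
  hom_counit := A.id_counit x
  hom_comul := A.id_comul x

end

theorem isAntipode_iff {A : SemiHopfCat V} {S : ∀ x y : A.carrier, (x ⟶[V] y) ⟶ (y ⟶[V] x)} :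
    A.IsAntipode S ↔ ∀ x y, IsConvInverse (𝟙 (x ⟶[V] y)) (S x y) := by
  refine forall₂_congr fun x y => ?_
  rw [← id_tensorHom, ← tensorHom_id]
  exact ⟨fun h => ⟨h.1, h.2⟩, fun h => ⟨h.1, h.2⟩⟩

namespace IsAntipode

variable {A : SemiHopfCat V} {S : ∀ x y : A.carrier, (x ⟶[V] y) ⟶ (y ⟶[V] x)}

theorem isConvInverse (hS : A.IsAntipode S) {C : V} [ComonObj C] {x y : A.carrier}
    (f : C ⟶ (x ⟶[V] y)) [IsComonHom f] : IsConvInverse f (f ≫ S x y) := by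
  simpa only [Category.comp_id] using (isAntipode_iff.1 hS x y).comp f

theorem eComp_comp (hS : A.IsAntipode S) (x y z : A.carrier) :
    eComp V x y z ≫ S x z = (β_ _ _).hom ≫ (S y z ⊗ₘ S x y) ≫ eComp V z y x := by
  have h := (isAntipode_iff.1 hS x y).tensorHom_comp_eComp (isAntipode_iff.1 hS y z)
  rw [id_tensorHom_id, Category.id_comp] at h
  exact (hS.isConvInverse _).unique h

theorem eId_comp (hS : A.IsAntipode S) (x : A.carrier) : eId V x ≫ S x x = eId V x := by
  let _ : ComonObj (𝟙_ V) := ComonObj.instTensorUnit V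
  have h : IsConvInverse (eId V x) (eId V x) := by
    simpa only [convUnit, ComonObj.instTensorUnit_counit, Category.id_comp] using
      IsConvInverse.convUnit (C := 𝟙_ V) x
  exact (hS.isConvInverse _).unique h

theorem comp_onHom {B : SemiHopfCat V} {S' : ∀ x y : B.carrier, (x ⟶[V] y) ⟶ (y ⟶[V] x)}
    (hS : A.IsAntipode S) (hS' : B.IsAntipode S') (F : A ⟶ B) {x y : A.carrier} {x' y' : B.carrier}
    (hx : onObj F x = x') (hy : onObj F y = y') :
    S x y ≫ onHom F hy hx = onHom F hx hy ≫ S' x' y' := by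
  have h := (isAntipode_iff.1 hS x y).onHom F hx hy
  rw [Category.id_comp] at h
  exact h.unique (hS'.isConvInverse _)

end IsAntipode

instance isHopf_isClosedUnderIsomorphisms : (isHopf V).IsClosedUnderIsomorphisms where
  of_iso {A B} e := by
    rintro ⟨S, hS⟩
    have hi : ∀ x : B.carrier, onObj e.hom (onObj e.inv x) = x := fun x =>
      congrArg (fun F : B ⟶ B => onObj F x) e.inv_hom_id
    refine ⟨fun x y => (onHom e.inv rfl rfl ≫ S (onObj e.inv x) (onObj e.inv y)) ≫
      onHom e.hom (hi y) (hi x), isAntipode_iff.2 fun x y => ?_⟩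
    have inv_hom : onHom e.inv (rfl : onObj e.inv x = _) (rfl : onObj e.inv y = _) ≫
        onHom e.hom (hi x) (hi y) = 𝟙 _ :=
      (onHom_onHom e.inv e.hom rfl rfl (hi x) (hi y)).trans
        ((onHom_congr e.inv_hom_id (hi x) (hi y)).trans (onHom_id_functor x y rfl rfl))
    rw [← inv_hom]
    exact (hS.isConvInverse _).onHom e.hom (hi x) (hi y)

end SemiHopfCat

/-! ### Colimits of semi-Hopf categories -/

section Enriched

variable {V : Type u} [Category.{v} V] [MonoidalCategory V] {B : Type w} [EnrichedCategory V B]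

theorem tensorHom_eId_eComp {X : V} {x y : B} (f : X ⟶ (x ⟶[V] y)) :
    (f ⊗ₘ eId V y) ≫ eComp V x y y = (ρ_ X).hom ≫ f := by
  rw [MonoidalCategory.tensorHom_def, Category.assoc, ← Iso.inv_comp_eq,
    ← rightUnitor_inv_naturality_assoc, e_comp_id, Category.comp_id]

theorem eId_tensorHom_eComp {X : V} {x y : B} (f : X ⟶ (x ⟶[V] y)) :
    (eId V x ⊗ₘ f) ≫ eComp V x x y = (λ_ X).hom ≫ f := by
  rw [MonoidalCategory.tensorHom_def', Category.assoc, ← Iso.inv_comp_eq,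
    ← leftUnitor_inv_naturality_assoc, e_id_comp, Category.comp_id]

theorem tensorHom_tensorHom_eComp {X Y Z : V} {x y z t : B} (f : X ⟶ (x ⟶[V] y))
    (g : Y ⟶ (y ⟶[V] z)) (h : Z ⟶ (z ⟶[V] t)) :
    (f ⊗ₘ ((g ⊗ₘ h) ≫ eComp V y z t)) ≫ eComp V x y t =
      (α_ _ _ _).inv ≫ (((f ⊗ₘ g) ≫ eComp V x y z) ⊗ₘ h) ≫ eComp V x z t := by
  have h₁ : f ⊗ₘ ((g ⊗ₘ h) ≫ eComp V y z t) = (f ⊗ₘ (g ⊗ₘ h)) ≫ _ ◁ eComp V y z t := by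
    rw [← id_tensorHom, tensorHom_comp_tensorHom, Category.comp_id]
  have h₂ : ((f ⊗ₘ g) ≫ eComp V x y z) ⊗ₘ h = ((f ⊗ₘ g) ⊗ₘ h) ≫ eComp V x y z ▷ _ := by
    rw [← tensorHom_id, tensorHom_comp_tensorHom, Category.comp_id]
  rw [h₁, h₂, Category.assoc, ← e_assoc, Category.assoc, associator_inv_naturality_assoc]

end Enriched

namespace SemiHopfCat

noncomputable section Colimits

variable {V : Type u} [Category.{v} V] [MonoidalCategory V] [BraidedCategory V]

theorem IsAntipode.eComp_comp_op {A : SemiHopfCat V}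
    {T : ∀ a b : A.carrier, (a ⟶[V] b) ⟶ (b ⟶[V] a)} (hT : A.IsAntipode T)
    {B : Type w} [EnrichedCategory V B] {x y z : B} {a b c : A.carrier}
    {p : (c ⟶[V] b) ⟶ (z ⟶[V] y)} {q : (b ⟶[V] a) ⟶ (y ⟶[V] x)} {r : (c ⟶[V] a) ⟶ (z ⟶[V] x)}
    (h : eComp V c b a ≫ r = (p ⊗ₘ q) ≫ eComp V z y x) :
    eComp V a b c ≫ T a c ≫ r = (T a b ≫ q ⊗ₘ T b c ≫ p) ≫
      eComp V (Opposite.op x) (Opposite.op y) (Opposite.op z) := by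
  rw [reassoc_of% hT.eComp_comp, h, tensorHom_eComp_op_eq, tensorHom_comp_tensorHom_assoc]

attribute [local instance] ComonObj.instTensorUnit

variable {J : Type v} [SmallCategory J] {F : J ⥤ SemiHopfCat V}

variable (F) in
/-- The colimit of the sets of objects of a diagram of semi-Hopf categories. -/
def ColimObj : Type v :=
  Quot fun p q : Σ j, (F.obj j).carrier => ∃ f : p.1 ⟶ q.1, onObj (F.map f) p.2 = q.2

/-- The class of an object in the colimit of the sets of objects. -/
def colimObj {j : J} (a : (F.obj j).carrier) : ColimObj F := Quot.mk _ ⟨j, a⟩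

theorem colimObj_map {j k : J} (f : j ⟶ k) (a : (F.obj j).carrier) :
    colimObj (onObj (F.map f) a) = colimObj a :=
  (Quot.sound ⟨f, rfl⟩).symm

variable (F) in
/-- A pair of objects of a member of the diagram with classes `x` and `z`. Classes are only required
to agree up to propositional equality, so that letters of different members can be composed. -/
structure Letter (x z : ColimObj F) : Type v where
  {index : J}
  {src : (F.obj index).carrier}
  {tgt : (F.obj index).carrier}
  src_eq : colimObj src = x
  tgt_eq : colimObj tgt = z

namespace Letter

variable {x z : ColimObj F} (l : Letter F x z)

/-- The Hom-object of a letter. -/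
abbrev obj : V := l.src ⟶[V] l.tgt

/-- The image of a letter under a functor of the diagram. -/
def map {k : J} (f : l.index ⟶ k) : Letter F x z :=
  ⟨(colimObj_map f l.src).trans l.src_eq, (colimObj_map f l.tgt).trans l.tgt_eq⟩

/-- The component of a functor of the diagram at a letter. -/
def mapHom {k : J} (f : l.index ⟶ k) : l.obj ⟶ (l.map f).obj :=
  onHom (F.map f) rfl rfl

instance {k : J} (f : l.index ⟶ k) : IsComonHom (l.mapHom f) :=
  inferInstanceAs (IsComonHom (onHom (F.map f) rfl rfl))

end Letter

variable (F) in
/-- Words of composable letters, starting at `y`. -/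
inductive Word (y : ColimObj F) : ColimObj F → Type v
  | nil : Word y y
  | snoc {x z : ColimObj F} (w : Word y x) (l : Letter F x z) : Word y z

namespace Word

variable {y : ColimObj F}

/-- The tensor product of the letters of a word. -/
@[reducible] def obj : ∀ {x : ColimObj F}, Word F y x → V
  | _, nil => 𝟙_ V
  | _, snoc w l => w.obj ⊗ l.obj

instance comon : ∀ {x : ColimObj F} (w : Word F y x), ComonObj w.obj
  | _, nil => inferInstanceAs (ComonObj (𝟙_ V))
  | _, snoc w l =>
    letI := w.comon
    inferInstanceAs (ComonObj (w.obj ⊗ l.obj))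

/-- Elementary steps between words: insertion of a unit, composition of the last two letters,
application of a functor of the diagram to the last letter, and any of these before further
letters. -/
inductive Step : ∀ {x : ColimObj F}, Word F y x → Word F y x → Type v
  | id {x : ColimObj F} (w : Word F y x) {j : J} {a : (F.obj j).carrier} (hx : colimObj a = x) :
      Step w (w.snoc ⟨hx, hx⟩)
  | comp {x x' z : ColimObj F} (w : Word F y x) {j : J} {a b c : (F.obj j).carrier}
      (hx : colimObj a = x) (hx' : colimObj b = x') (hz : colimObj c = z) :
      Step ((w.snoc ⟨hx, hx'⟩).snoc ⟨hx', hz⟩) (w.snoc ⟨hx, hz⟩)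
  | map {x z : ColimObj F} (w : Word F y x) (l : Letter F x z) {k : J} (f : l.index ⟶ k) :
      Step (w.snoc l) (w.snoc (l.map f))
  | congr {x z : ColimObj F} {w w' : Word F y x} (s : Step w w') (l : Letter F x z) :
      Step (w.snoc l) (w'.snoc l)

namespace Step

/-- The morphism of an elementary step. -/
def hom : ∀ {x : ColimObj F} {w w' : Word F y x}, Step w w' → (w.obj ⟶ w'.obj)
  | _, _, _, .id (a := a) w _ => (ρ_ w.obj).inv ≫ w.obj ◁ eId V a
  | _, _, _, .comp (a := a) (b := b) (c := c) w _ _ _ =>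
    (α_ w.obj (a ⟶[V] b) (b ⟶[V] c)).hom ≫ w.obj ◁ eComp V a b c
  | _, _, _, .map w l f => w.obj ◁ l.mapHom f
  | _, _, _, .congr s l => s.hom ▷ l.obj

instance isComonHom {x : ColimObj F} {w w' : Word F y x} (s : Step w w') : IsComonHom s.hom := by
  induction s with
  | @id _ w _ a _ => exact inferInstanceAs (IsComonHom ((ρ_ w.obj).inv ≫ w.obj ◁ eId V a))
  | @comp _ _ _ w _ a b c _ _ _ =>
    exact inferInstanceAs (IsComonHom
      ((α_ w.obj (a ⟶[V] b) (b ⟶[V] c)).hom ≫ w.obj ◁ eComp V a b c))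
  | map w l f => exact inferInstanceAs (IsComonHom (w.obj ◁ l.mapHom f))
  | congr s l ih => exact inferInstanceAs (IsComonHom (s.hom ▷ l.obj))

end Step

instance (x : ColimObj F) : Quiver (Word F y x) where
  Hom := Step

/-- The tensor products of words and the morphisms of elementary steps, before passing to paths. -/
def stepPrefunctor (y x : ColimObj F) : Word F y x ⥤q Comon V where
  obj w := ⟨w.obj⟩
  map s := Comon.Hom.mk (Step.hom s)

/-- The diagram of the words from `y` to `x` and the elementary steps between them. -/
def diagram (y x : ColimObj F) : Paths (Word F y x) ⥤ Comon V :=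
  Paths.lift (stepPrefunctor y x)

theorem diagram_map_toPath {x : ColimObj F} {w w' : Word F y x} (s : w ⟶ w') :
    ((diagram y x).map s.toPath).hom = Step.hom s :=
  congrArg Comon.Hom.hom (Paths.lift_toPath (stepPrefunctor y x) s)

end Word

section

variable [HasColimits V]

/-- The comonoid of words modulo elementary steps. -/
def colimComon (y x : ColimObj F) : Comon V := colimit (Word.diagram y x)

/-- The Hom-objects of the colimit. -/
abbrev ColimHom (y x : ColimObj F) : V := (colimComon y x).X

/-- The class of a word in a Hom-object of the colimit. -/
def wordι {y x : ColimObj F} (w : Word F y x) : w.obj ⟶ ColimHom y x :=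
  (colimit.ι (Word.diagram y x) w).hom

instance wordι_isComonHom {y x : ColimObj F} (w : Word F y x) : IsComonHom (wordι w) :=
  (colimit.ι (Word.diagram y x) w).isComonHom_hom

theorem step_wordι {y x : ColimObj F} {w w' : Word F y x} (s : w.Step w') :
    s.hom ≫ wordι w' = wordι w := by
  rw [← Word.diagram_map_toPath (show w ⟶ w' from s)]
  exact congrArg Comon.Hom.hom (colimit.w (Word.diagram y x) (show w ⟶ w' from s).toPath)

section

variable {D : Type*} [Category.{v} D] (G : V ⥤ D) [PreservesColimits G]

theorem colimHom_ext {y x : ColimObj F} {Z : D} {f g : G.obj (ColimHom y x) ⟶ Z}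
    (h : ∀ w : Word F y x, G.map (wordι w) ≫ f = G.map (wordι w) ≫ g) : f = g :=
  (isColimitOfPreserves (Comon.forget V ⋙ G) (colimit.isColimit (Word.diagram y x))).hom_ext h

/-- The morphism out of the image under `G` of a Hom-object of the colimit that is given by a
family of morphisms compatible with the elementary steps. -/
def colimHomDesc {y x : ColimObj F} {Z : D} (φ : ∀ w : Word F y x, G.obj w.obj ⟶ Z)
    (hφ : ∀ {w w' : Word F y x} (s : w.Step w'), G.map s.hom ≫ φ w' = φ w) :
    G.obj (ColimHom y x) ⟶ Z :=
  (isColimitOfPreserves (Comon.forget V ⋙ G) (colimit.isColimit (Word.diagram y x))).desc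
    (Cocone.mk Z (Paths.liftNatTrans φ fun {w w'} s => by
      refine Eq.trans ?_ ((hφ s).trans (Category.comp_id _).symm)
      exact congrArg (G.map · ≫ φ w') (Word.diagram_map_toPath s)))

theorem map_wordι_colimHomDesc {y x : ColimObj F} {Z : D} (φ : ∀ w : Word F y x, G.obj w.obj ⟶ Z)
    (hφ : ∀ {w w' : Word F y x} (s : w.Step w'), G.map s.hom ≫ φ w' = φ w) (w : Word F y x) :
    G.map (wordι w) ≫ colimHomDesc G φ hφ = φ w :=
  (isColimitOfPreserves (Comon.forget V ⋙ G) (colimit.isColimit (Word.diagram y x))).fac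
    (Cocone.mk Z (Paths.liftNatTrans φ _)) w

end

variable [∀ A : V, PreservesColimits (tensorLeft A)]

instance (A : V) : PreservesColimits (tensorRight A) :=
  preservesColimits_of_natIso (BraidedCategory.tensorLeftIsoTensorRight A)

/-- The right action of a letter on the Hom-objects of the colimit. -/
def colimAct {y x z : ColimObj F} (l : Letter F x z) : ColimHom y x ⊗ l.obj ⟶ ColimHom y z :=
  colimHomDesc (tensorRight l.obj) (fun w => wordι (w.snoc l)) fun s => step_wordι (s.congr l)

theorem wordι_colimAct {y x z : ColimObj F} (w : Word F y x) (l : Letter F x z) :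
    wordι w ▷ l.obj ≫ colimAct l = wordι (w.snoc l) :=
  map_wordι_colimHomDesc (tensorRight l.obj) _ (fun s => step_wordι (s.congr l)) w

instance colimAct_isComonHom {y x z : ColimObj F} (l : Letter F x z) :
    IsComonHom (colimAct (y := y) l) where
  hom_counit := colimHom_ext (tensorRight l.obj) fun w => by
    change wordι w ▷ l.obj ≫ _ = wordι w ▷ l.obj ≫ _
    rw [reassoc_of% wordι_colimAct w l, IsComonHom.hom_counit, IsComonHom.hom_counit]
  hom_comul := colimHom_ext (tensorRight l.obj) fun w => by
    change wordι w ▷ l.obj ≫ _ = wordι w ▷ l.obj ≫ _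
    rw [reassoc_of% wordι_colimAct w l, IsComonHom.hom_comul, IsComonHom.hom_comul_assoc,
      tensorHom_comp_tensorHom, wordι_colimAct]

theorem colimAct_id {y x : ColimObj F} {j : J} {a : (F.obj j).carrier} (hx : colimObj a = x) :
    ColimHom y x ◁ eId V a ≫ colimAct ⟨hx, hx⟩ = (ρ_ _).hom := by
  refine colimHom_ext (tensorRight (𝟙_ V)) fun w => ?_
  change wordι w ▷ 𝟙_ V ≫ _ = wordι w ▷ 𝟙_ V ≫ _
  rw [← whisker_exchange_assoc, wordι_colimAct w ⟨hx, hx⟩, rightUnitor_naturality,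
    ← step_wordι (.id w hx)]
  simp [Word.Step.hom]

theorem colimAct_comp {y x x' z : ColimObj F} {j : J} {a b c : (F.obj j).carrier}
    (hx : colimObj a = x) (hx' : colimObj b = x') (hz : colimObj c = z) :
    (α_ (ColimHom y x) _ _).hom ≫ ColimHom y x ◁ eComp V a b c ≫ colimAct ⟨hx, hz⟩ =
      colimAct ⟨hx, hx'⟩ ▷ _ ≫ colimAct ⟨hx', hz⟩ := by
  rw [← cancel_epi (α_ _ _ _).inv, Iso.inv_hom_id_assoc]
  refine colimHom_ext (tensorRight _) fun w => ?_
  change wordι w ▷ _ ≫ _ = wordι w ▷ _ ≫ _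
  rw [← whisker_exchange_assoc, wordι_colimAct w ⟨hx, hz⟩, associator_inv_naturality_left_assoc,
    ← comp_whiskerRight_assoc, wordι_colimAct w ⟨hx, hx'⟩, wordι_colimAct _ ⟨hx', hz⟩,
    ← cancel_epi (α_ _ _ _).hom, Iso.hom_inv_id_assoc, ← step_wordι (.comp w hx hx' hz)]
  exact (Category.assoc _ _ _).symm

theorem colimAct_map {y x z : ColimObj F} (l : Letter F x z) {k : J} (f : l.index ⟶ k) :
    ColimHom y x ◁ l.mapHom f ≫ colimAct (l.map f) = colimAct l := by
  refine colimHom_ext (tensorRight l.obj) fun w => ?_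
  change wordι w ▷ l.obj ≫ _ = wordι w ▷ l.obj ≫ _
  rw [← whisker_exchange_assoc, wordι_colimAct, wordι_colimAct]
  exact step_wordι (.map w l f)

/-- The action of the letters of a word, one after the other. -/
def wordAct {y x : ColimObj F} : ∀ {z : ColimObj F} (w : Word F x z),
    ColimHom y x ⊗ w.obj ⟶ ColimHom y z
  | _, .nil => (ρ_ _).hom
  | _, .snoc w l => (α_ _ w.obj l.obj).inv ≫ wordAct w ▷ _ ≫ colimAct l

theorem step_wordAct {y x z : ColimObj F} {w w' : Word F x z} (s : w.Step w') :
    ColimHom y x ◁ s.hom ≫ wordAct w' = wordAct w := by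
  induction s with
  | @id _ w _ a hx =>
    change ColimHom y x ◁ ((ρ_ w.obj).inv ≫ w.obj ◁ eId V a) ≫ (α_ _ w.obj _).inv ≫
      wordAct w ▷ _ ≫ colimAct ⟨hx, hx⟩ = wordAct w
    rw [MonoidalCategory.whiskerLeft_comp, Category.assoc,
      associator_inv_naturality_right_assoc, whisker_exchange_assoc, colimAct_id]
    simp
  | @comp _ _ _ w _ a b c hx hx' hz =>
    change ColimHom y x ◁ ((α_ w.obj (a ⟶[V] b) (b ⟶[V] c)).hom ≫ w.obj ◁ eComp V a b c) ≫
      (α_ _ w.obj _).inv ≫ wordAct w ▷ _ ≫ colimAct ⟨hx, hz⟩ =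
      (α_ _ (w.obj ⊗ (a ⟶[V] b)) _).inv ≫
        ((α_ _ w.obj (a ⟶[V] b)).inv ≫ wordAct w ▷ _ ≫ colimAct ⟨hx, hx'⟩) ▷ _ ≫
          colimAct ⟨hx', hz⟩
    rw [comp_whiskerRight, comp_whiskerRight, Category.assoc, Category.assoc,
      ← colimAct_comp hx hx' hz, MonoidalCategory.whiskerLeft_comp, Category.assoc,
      associator_inv_naturality_right_assoc, whisker_exchange_assoc]
    simp
  | map w l f =>
    change ColimHom y x ◁ (w.obj ◁ l.mapHom f) ≫ (α_ _ w.obj _).inv ≫ wordAct w ▷ _ ≫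
      colimAct (l.map f) = (α_ _ w.obj _).inv ≫ wordAct w ▷ _ ≫ colimAct l
    rw [associator_inv_naturality_right_assoc, whisker_exchange_assoc, colimAct_map]
  | @congr _ _ w w' s l ih =>
    change ColimHom y x ◁ (s.hom ▷ l.obj) ≫ (α_ _ w'.obj _).inv ≫ wordAct w' ▷ _ ≫ colimAct l =
      (α_ _ w.obj _).inv ≫ wordAct w ▷ _ ≫ colimAct l
    rw [← ih]
    simp

instance wordAct_isComonHom {y x z : ColimObj F} (w : Word F x z) :
    IsComonHom (wordAct (y := y) w) := by
  induction w with
  | nil => exact inferInstanceAs (IsComonHom (ρ_ (ColimHom y x)).hom)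
  | snoc w l ih =>
    exact inferInstanceAs (IsComonHom ((α_ (ColimHom y x) w.obj l.obj).inv ≫
      wordAct w ▷ _ ≫ colimAct l))

/-- The units of the colimit. -/
def colimId (y : ColimObj F) : 𝟙_ V ⟶ ColimHom y y := wordι (Word.nil (y := y))

instance (y : ColimObj F) : IsComonHom (colimId y) :=
  wordι_isComonHom (Word.nil (y := y))

/-- The composition of the colimit. -/
def colimComp (x y z : ColimObj F) : ColimHom x y ⊗ ColimHom y z ⟶ ColimHom x z :=
  colimHomDesc (tensorLeft _) wordAct step_wordAct

theorem wordι_colimComp (x : ColimObj F) {y z : ColimObj F} (w : Word F y z) :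
    ColimHom x y ◁ wordι w ≫ colimComp x y z = wordAct w :=
  map_wordι_colimHomDesc (tensorLeft _) _ _ w

instance colimComp_isComonHom (x y z : ColimObj F) : IsComonHom (colimComp x y z) where
  hom_counit := colimHom_ext (tensorLeft _) fun w => by
    change _ ◁ wordι w ≫ _ = _ ◁ wordι w ≫ _
    rw [reassoc_of% wordι_colimComp x w, IsComonHom.hom_counit, IsComonHom.hom_counit]
  hom_comul := colimHom_ext (tensorLeft _) fun w => by
    change _ ◁ wordι w ≫ _ = _ ◁ wordι w ≫ _
    rw [reassoc_of% wordι_colimComp x w, IsComonHom.hom_comul, IsComonHom.hom_comul_assoc,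
      tensorHom_comp_tensorHom, wordι_colimComp]

theorem colimComp_colimId (x y : ColimObj F) :
    ColimHom x y ◁ colimId _ ≫ colimComp x y y = (ρ_ _).hom :=
  wordι_colimComp x (Word.nil (y := y))

theorem colimAct_colimComp (x y : ColimObj F) {z z' : ColimObj F} (l : Letter F z z') :
    ColimHom x y ◁ colimAct l ≫ colimComp x y z' =
      (α_ _ _ _).inv ≫ colimComp x y z ▷ _ ≫ colimAct l := by
  rw [← cancel_epi (α_ _ _ _).hom, Iso.hom_inv_id_assoc]
  refine colimHom_ext (tensorLeft (ColimHom x y) ⋙ tensorRight l.obj) fun w => ?_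
  change (ColimHom x y ◁ wordι w) ▷ l.obj ≫ _ = (ColimHom x y ◁ wordι w) ▷ l.obj ≫ _
  rw [associator_naturality_middle_assoc, ← MonoidalCategory.whiskerLeft_comp_assoc,
    wordι_colimAct, ← comp_whiskerRight_assoc, wordι_colimComp, wordι_colimComp]
  exact Iso.hom_inv_id_assoc _ _

theorem equivariant_ext {y : ColimObj F} {X : V} {Z : ColimObj F → V}
    (act : ∀ {x z : ColimObj F} (l : Letter F x z), Z x ⊗ l.obj ⟶ Z z)
    {f g : ∀ x, X ⊗ ColimHom y x ⟶ Z x}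
    (hf : ∀ {x z : ColimObj F} (l : Letter F x z),
      X ◁ colimAct l ≫ f z = (α_ _ _ _).inv ≫ f x ▷ _ ≫ act l)
    (hg : ∀ {x z : ColimObj F} (l : Letter F x z),
      X ◁ colimAct l ≫ g z = (α_ _ _ _).inv ≫ g x ▷ _ ≫ act l)
    (h : X ◁ colimId _ ≫ f y = X ◁ colimId _ ≫ g y) (x : ColimObj F) : f x = g x := by
  refine colimHom_ext (tensorLeft X) fun w => ?_
  induction w with
  | nil => exact h
  | snoc w l ih =>
    change X ◁ wordι w ≫ _ = X ◁ wordι w ≫ _ at ih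
    change X ◁ wordι (w.snoc l) ≫ _ = X ◁ wordι (w.snoc l) ≫ _
    rw [← wordι_colimAct, MonoidalCategory.whiskerLeft_comp, Category.assoc, Category.assoc, hf, hg,
      associator_inv_naturality_middle_assoc, associator_inv_naturality_middle_assoc,
      ← comp_whiskerRight_assoc, ← comp_whiskerRight_assoc, ih]

theorem colimId_colimComp (x y : ColimObj F) :
    colimId _ ▷ ColimHom x y ≫ colimComp x x y = (λ_ _).hom := by
  refine equivariant_ext (X := 𝟙_ V) (Z := ColimHom x) colimAct
    (f := fun y => colimId _ ▷ ColimHom x y ≫ colimComp x x y) (g := fun y => (λ_ _).hom)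
    (fun l => ?_) (fun l => ?_) ?_ y
  · rw [whisker_exchange_assoc, colimAct_colimComp]
    simp
  · simp
  · rw [whisker_exchange_assoc, colimComp_colimId, rightUnitor_naturality, leftUnitor_naturality,
      unitors_equal]

theorem colimComp_assoc (w x y z : ColimObj F) :
    (α_ _ _ _).inv ≫ colimComp w x y ▷ ColimHom y z ≫ colimComp w y z =
      ColimHom w x ◁ colimComp x y z ≫ colimComp w x z := by
  rw [Iso.inv_comp_eq]
  refine equivariant_ext (Z := ColimHom w) colimAct
    (f := fun z => colimComp w x y ▷ ColimHom y z ≫ colimComp w y z)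
    (g := fun z => (α_ _ _ _).hom ≫ ColimHom w x ◁ colimComp x y z ≫ colimComp w x z)
    (fun l => ?_) (fun l => ?_) ?_ z
  · rw [whisker_exchange_assoc, colimAct_colimComp]
    simp
  · rw [associator_naturality_right_assoc, ← MonoidalCategory.whiskerLeft_comp_assoc,
      colimAct_colimComp]
    simp only [MonoidalCategory.whiskerLeft_comp, Category.assoc, colimAct_colimComp]
    simp
  · rw [whisker_exchange_assoc, colimComp_colimId, associator_naturality_right_assoc,
      ← MonoidalCategory.whiskerLeft_comp_assoc, colimComp_colimId]
    simp

instance : EnrichedCategory V (ColimObj F) where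
  Hom := ColimHom
  id := colimId
  comp := colimComp
  id_comp x y := by rw [colimId_colimComp, Iso.inv_hom_id]
  comp_id x y := by rw [colimComp_colimId, Iso.inv_hom_id]
  assoc := colimComp_assoc

instance (x y : ColimObj F) : ComonObj (x ⟶[V] y) := (colimComon x y).comon

variable (F) in
/-- The colimit of a diagram of semi-Hopf categories. -/
abbrev colimCat : SemiHopfCat V where
  carrier := ColimObj F
  comp_comul x y z := by
    have h := IsComonHom.hom_comul (colimComp x y z)
    rw [Comon.tensorObj_comul, Category.assoc] at h
    exact h
  comp_counit x y z := IsComonHom.hom_counit (colimComp x y z)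
  id_comul x := IsComonHom.hom_comul (colimId x)
  id_counit x := IsComonHom.hom_counit (colimId x)

end

variable (F) in
/-- A cocone of `V`-functors from the members of the diagram to a `V`-category, given by its values
on letters. -/
structure EnrichedCocone (B : Type w) [EnrichedCategory V B] where
  obj : ColimObj F → B
  map {x z : ColimObj F} (l : Letter F x z) : l.obj ⟶ (obj x ⟶[V] obj z)
  eId_map {x : ColimObj F} {j : J} {a : (F.obj j).carrier} (hx : colimObj a = x) :
    eId V a ≫ map ⟨hx, hx⟩ = eId V (obj x)
  eComp_map {x y z : ColimObj F} {j : J} {a b c : (F.obj j).carrier} (hx : colimObj a = x)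
    (hy : colimObj b = y) (hz : colimObj c = z) :
    eComp V a b c ≫ map ⟨hx, hz⟩ = (map ⟨hx, hy⟩ ⊗ₘ map ⟨hy, hz⟩) ≫ eComp V _ _ _
  mapHom_map {x z : ColimObj F} (l : Letter F x z) {k : J} (f : l.index ⟶ k) :
    l.mapHom f ≫ map (l.map f) = map l

namespace EnrichedCocone

variable {B : Type w} [EnrichedCategory V B] (M : EnrichedCocone F B)

/-- The component of a cocone at an index. -/
def component (j : J) : EnrichedFunctor V (F.obj j).carrier B where
  obj a := M.obj (colimObj a)
  map _ _ := M.map ⟨rfl, rfl⟩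
  map_id _ := M.eId_map rfl
  map_comp _ _ _ := M.eComp_map rfl rfl rfl

/-- The value of a cocone on a word. -/
def word {y : ColimObj F} : ∀ {x : ColimObj F} (w : Word F y x), w.obj ⟶ (M.obj y ⟶[V] M.obj x)
  | _, .nil => eId V (M.obj y)
  | _, .snoc w l => (word w ⊗ₘ M.map l) ≫ eComp V _ _ _

theorem word_snoc {y x z : ColimObj F} (w : Word F y x) (l : Letter F x z) :
    M.word (w.snoc l) = (M.word w ⊗ₘ M.map l) ≫ eComp V _ _ _ :=
  rfl

theorem step_word {y x : ColimObj F} {w w' : Word F y x} (s : w.Step w') :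
    s.hom ≫ M.word w' = M.word w := by
  induction s with
  | @id _ w _ a hx =>
    rw [word_snoc, Word.Step.hom, Category.assoc, ← id_tensorHom, tensorHom_comp_tensorHom_assoc,
      Category.id_comp, M.eId_map hx, tensorHom_eId_eComp, Iso.inv_hom_id_assoc]
  | @comp _ _ _ w _ a b c hx hx' hz =>
    rw [word_snoc, word_snoc, word_snoc, Word.Step.hom, Category.assoc, ← id_tensorHom,
      tensorHom_comp_tensorHom_assoc, Category.id_comp, M.eComp_map hx hx' hz,
      tensorHom_tensorHom_eComp, Iso.hom_inv_id_assoc]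
  | map w l f =>
    rw [word_snoc, word_snoc, Word.Step.hom, ← id_tensorHom, tensorHom_comp_tensorHom_assoc,
      Category.id_comp, M.mapHom_map]
  | congr s l ih =>
    rw [word_snoc, word_snoc, Word.Step.hom, ← tensorHom_id, tensorHom_comp_tensorHom_assoc,
      Category.id_comp, ih]

variable [HasColimits V]

/-- The components of the functor out of the colimit induced by a cocone. -/
def liftHom (y x : ColimObj F) : ColimHom y x ⟶ (M.obj y ⟶[V] M.obj x) :=
  colimHomDesc (𝟭 V) M.word M.step_word

theorem wordι_liftHom {y x : ColimObj F} (w : Word F y x) :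
    wordι w ≫ M.liftHom y x = M.word w :=
  map_wordι_colimHomDesc (𝟭 V) M.word M.step_word w

variable [∀ A : V, PreservesColimits (tensorLeft A)]

theorem colimAct_liftHom (y : ColimObj F) {x z : ColimObj F} (l : Letter F x z) :
    colimAct l ≫ M.liftHom y z = (M.liftHom y x ⊗ₘ M.map l) ≫ eComp V _ _ _ :=
  colimHom_ext (tensorRight l.obj) fun w => by
    change wordι w ▷ l.obj ≫ _ = wordι w ▷ l.obj ≫ _
    rw [reassoc_of% wordι_colimAct w l, wordι_liftHom, ← tensorHom_id,
      tensorHom_comp_tensorHom_assoc, Category.id_comp, wordι_liftHom, word_snoc]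

theorem wordAct_liftHom (x : ColimObj F) {y z : ColimObj F} (w : Word F y z) :
    wordAct w ≫ M.liftHom x z = (M.liftHom x y ⊗ₘ M.word w) ≫ eComp V _ _ _ := by
  induction w with
  | nil => exact (tensorHom_eId_eComp _).symm
  | snoc w l ih =>
    rw [word_snoc, tensorHom_tensorHom_eComp, ← ih, wordAct, Category.assoc, Category.assoc,
      colimAct_liftHom, ← tensorHom_id, tensorHom_comp_tensorHom_assoc, Category.id_comp]

/-- The functor out of the colimit induced by a cocone. -/
def lift : EnrichedFunctor V (ColimObj F) B where
  obj := M.obj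
  map := M.liftHom
  map_id y := M.wordι_liftHom (Word.nil (y := y))
  map_comp x y z := colimHom_ext (tensorLeft (ColimHom x y)) fun w => by
    change ColimHom x y ◁ wordι w ≫ colimComp x y z ≫ _ = ColimHom x y ◁ wordι w ≫ _
    rw [reassoc_of% wordι_colimComp x w, wordAct_liftHom, ← id_tensorHom,
      tensorHom_comp_tensorHom_assoc, Category.id_comp, wordι_liftHom]

end EnrichedCocone

section

variable {A : SemiHopfCat V} (M : EnrichedCocone F A.carrier)
  [∀ {x z : ColimObj F} (l : Letter F x z), IsComonHom (M.map l)]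

instance word_isComonHom {y x : ColimObj F} (w : Word F y x) : IsComonHom (M.word w) := by
  induction w with
  | nil => exact inferInstanceAs (IsComonHom (eId V (M.obj y)))
  | snoc w l ih => exact inferInstanceAs (IsComonHom ((M.word w ⊗ₘ M.map l) ≫ eComp V _ _ _))

instance liftHom_isComonHom [HasColimits V] (y x : ColimObj F) : IsComonHom (M.liftHom y x) where
  hom_counit := colimHom_ext (𝟭 V) fun w => by
    change wordι w ≫ _ = wordι w ≫ _
    rw [reassoc_of% M.wordι_liftHom w, IsComonHom.hom_counit, IsComonHom.hom_counit]
  hom_comul := colimHom_ext (𝟭 V) fun w => by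
    change wordι w ≫ _ = wordι w ≫ _
    rw [reassoc_of% M.wordι_liftHom w, IsComonHom.hom_comul, IsComonHom.hom_comul_assoc,
      tensorHom_comp_tensorHom, M.wordι_liftHom]

end

section

variable (s : Cocone F)

/-- The action on objects of the functor induced by a cocone. -/
def descObj : ColimObj F → s.pt.carrier :=
  Quot.lift (fun p => onObj (s.ι.app p.1) p.2) (by
    rintro p q ⟨f, hf⟩
    rw [← hf]
    exact (congrArg (fun G => onObj G p.2) (s.w f)).symm)

theorem onObj_eq_descObj {j : J} {a : (F.obj j).carrier} {x : ColimObj F} (hx : colimObj a = x) :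
    onObj (s.ι.app j) a = descObj s x := by
  subst hx; rfl

/-- The cocone of `V`-functors underlying a cocone of semi-Hopf functors. -/
def enrichedCocone : EnrichedCocone F s.pt.carrier where
  obj := descObj s
  map l := onHom (s.ι.app l.index) (onObj_eq_descObj s l.src_eq) (onObj_eq_descObj s l.tgt_eq)
  eId_map _ := onHom_id _ _ _
  eComp_map _ _ _ := onHom_comp _ _ _ _
  mapHom_map l _ f :=
    (onHom_onHom _ _ rfl rfl (onObj_eq_descObj s (l.map f).src_eq)
      (onObj_eq_descObj s (l.map f).tgt_eq)).trans (onHom_congr (s.w f) _ _)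

end

variable [HasColimits V] [∀ A : V, PreservesColimits (tensorLeft A)]

section Letters

variable {x z : ColimObj F} (l : Letter F x z)

/-- The class of a letter in a Hom-object of the colimit. -/
def letterι : l.obj ⟶ ColimHom x z := (λ_ _).inv ≫ colimId x ▷ _ ≫ colimAct l

instance letterι_isComonHom : IsComonHom (letterι l) :=
  inferInstanceAs (IsComonHom ((λ_ _).inv ≫ colimId x ▷ _ ≫ colimAct l))

theorem letterι_colimComp (y : ColimObj F) :
    ColimHom y x ◁ letterι l ≫ colimComp y x z = colimAct l := by
  rw [letterι, MonoidalCategory.whiskerLeft_comp_assoc, MonoidalCategory.whiskerLeft_comp_assoc,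
    colimAct_colimComp, associator_inv_naturality_middle_assoc, ← comp_whiskerRight_assoc,
    colimComp_colimId]
  simp

end Letters

variable (F) in
/-- The universal cocone, whose vertex is the colimit. -/
def letterCocone : EnrichedCocone F (ColimObj F) where
  obj := id
  map := letterι
  eId_map {x} _ a hx := by
    change eId V a ≫ letterι ⟨hx, hx⟩ = colimId x
    rw [letterι, leftUnitor_inv_naturality_assoc, whisker_exchange_assoc, colimAct_id hx,
      rightUnitor_naturality, ← unitors_equal, Iso.inv_hom_id_assoc]
  eComp_map {x y z} _ a b c hx hy hz := by
    change _ = (letterι ⟨hx, hy⟩ ⊗ₘ letterι ⟨hy, hz⟩) ≫ colimComp x y z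
    rw [MonoidalCategory.tensorHom_def, Category.assoc, letterι_colimComp ⟨hy, hz⟩, letterι,
      letterι, comp_whiskerRight, comp_whiskerRight, Category.assoc, Category.assoc,
      ← colimAct_comp hx hy hz, leftUnitor_inv_naturality_assoc, whisker_exchange_assoc]
    simp
  mapHom_map l _ f := by
    rw [letterι, leftUnitor_inv_naturality_assoc, whisker_exchange_assoc, colimAct_map, letterι]

theorem wordι_snoc {y x z : ColimObj F} (w : Word F y x) (l : Letter F x z) :
    wordι (w.snoc l) = (wordι w ⊗ₘ letterι l) ≫ eComp V y x z := by
  rw [← wordι_colimAct, ← letterι_colimComp l y, MonoidalCategory.tensorHom_def, Category.assoc]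
  rfl

theorem letterι_lift {B : Type w} [EnrichedCategory V B] (M : EnrichedCocone F B)
    {x z : ColimObj F} (l : Letter F x z) : letterι l ≫ M.lift.map x z = M.map l := by
  change letterι l ≫ M.liftHom x z = _
  have h : colimId x ≫ M.liftHom x x = eId V (M.obj x) := M.lift.map_id x
  rw [letterι, Category.assoc, Category.assoc, M.colimAct_liftHom, ← tensorHom_id,
    tensorHom_comp_tensorHom_assoc, Category.id_comp, h, eId_tensorHom_eComp,
    Iso.inv_hom_id_assoc]

/-- The components of the colimit cocone. -/
def colimι (j : J) : F.obj j ⟶ colimCat F :=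
  show Hom (F.obj j) (colimCat F) from
    { toFunctor := (letterCocone F).component j
      isComonHom := fun a _ => letterι_isComonHom (F := F) (x := colimObj a) ⟨rfl, rfl⟩ }

theorem onHom_colimι {x z : ColimObj F} (l : Letter F x z) :
    onHom (colimι l.index) l.src_eq l.tgt_eq = letterι l := by
  obtain ⟨rfl, rfl⟩ := l
  exact onHom_rfl _ _ _

variable (F) in
/-- The colimit cocone. -/
def colimCocone : Cocone F where
  pt := colimCat F
  ι :=
    { app := colimι
      naturality := fun j k f => by
        refine (hom_ext (A := F.obj j) (B := colimCat F) (F := F.map f ≫ colimι k)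
          (G := colimι j) (colimObj_map f) fun a b => ?_).trans (Category.comp_id _).symm
        refine (onHom_onHom (F.map f) (colimι k) rfl rfl (colimObj_map f a)
          (colimObj_map f b)).symm.trans ?_
        refine (congrArg (_ ≫ ·)
          (onHom_colimι (.mk (colimObj_map f a) (colimObj_map f b)))).trans ?_
        exact ((letterCocone F).mapHom_map (x := colimObj a) ⟨rfl, rfl⟩ f).trans
          (onHom_colimι ⟨rfl, rfl⟩).symm }

section Desc

variable (s : Cocone F)

instance {x z : ColimObj F} (l : Letter F x z) : IsComonHom ((enrichedCocone s).map l) :=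
  onHom_isComonHom (s.ι.app l.index) (onObj_eq_descObj s l.src_eq)
    (onObj_eq_descObj s l.tgt_eq)

/-- The functor induced by a cocone. -/
def colimDesc : colimCat F ⟶ s.pt :=
  show Hom (colimCat F) s.pt from
    { toFunctor := (enrichedCocone s).lift
      isComonHom := liftHom_isComonHom (enrichedCocone s) }

variable {s} {m : colimCat F ⟶ s.pt}

theorem onObj_of_fac (hm : ∀ j, colimι j ≫ m = s.ι.app j) (x : ColimObj F) :
    onObj m x = descObj s x := by
  obtain ⟨j, a⟩ := x
  exact congrArg (fun G => onObj G a) (hm j)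

variable (hm : ∀ j, colimι j ≫ m = s.ι.app j)

theorem letterι_onHom_of_fac {x z : ColimObj F} (l : Letter F x z) :
    letterι l ≫ onHom m (onObj_of_fac hm x) (onObj_of_fac hm z) = (enrichedCocone s).map l := by
  obtain ⟨rfl, rfl⟩ := l
  refine (congrArg (· ≫ _) (onHom_colimι ⟨rfl, rfl⟩).symm).trans ?_
  exact (onHom_onHom _ _ _ _ _ _).trans (onHom_congr (hm _) _ _)

theorem wordι_onHom_of_fac {y x : ColimObj F} (w : Word F y x) :
    wordι w ≫ onHom m (onObj_of_fac hm y) (onObj_of_fac hm x) = (enrichedCocone s).word w := by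
  induction w with
  | nil => exact onHom_id m _ _
  | snoc w l ih =>
    rw [wordι_snoc, Category.assoc]
    refine (congrArg (_ ≫ ·) (onHom_comp m _ (onObj_of_fac hm _) _)).trans ?_
    rw [tensorHom_comp_tensorHom_assoc, ih, letterι_onHom_of_fac hm]
    rfl

theorem onHom_of_fac (y x : ColimObj F) :
    onHom m (onObj_of_fac hm y) (onObj_of_fac hm x) = (enrichedCocone s).liftHom y x :=
  colimHom_ext (𝟭 V) fun w =>
    (wordι_onHom_of_fac hm w).trans ((enrichedCocone s).wordι_liftHom w).symm

end Desc

variable (F) in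
/-- The universal property of the colimit cocone. -/
def colimCoconeIsColimit : IsColimit (colimCocone F) where
  desc := colimDesc
  fac s j := hom_ext (A := F.obj j) (F := colimι j ≫ colimDesc s) (G := s.ι.app j)
    (fun a => rfl) fun a b => by
      refine (onHom_onHom (colimι j) (colimDesc s) rfl rfl rfl rfl).symm.trans ?_
      refine (congrArg (· ≫ _) (onHom_colimι ⟨rfl, rfl⟩)).trans ?_
      refine (congrArg (_ ≫ ·) (onHom_rfl (colimDesc s) (colimObj a) (colimObj b))).trans ?_
      exact letterι_lift (enrichedCocone s) ⟨rfl, rfl⟩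
  uniq s m hm := hom_ext (A := colimCat F) (F := m) (G := colimDesc s) (onObj_of_fac hm)
    fun y x => (onHom_of_fac hm y x).trans (onHom_rfl (colimDesc s) y x).symm

theorem hasColimits : HasColimits (SemiHopfCat V) where
  has_colimits_of_shape _ _ := ⟨fun F => ⟨⟨⟨colimCocone F, colimCoconeIsColimit F⟩⟩⟩⟩

section Antipode

/-- A letter read backwards. -/
def Letter.swap {x z : ColimObj F} (l : Letter F x z) : Letter F z x := ⟨l.tgt_eq, l.src_eq⟩

variable {S : ∀ j, ∀ a b : (F.obj j).carrier, (a ⟶[V] b) ⟶ (b ⟶[V] a)}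
  (hS : ∀ j, (F.obj j).IsAntipode (S j))

/-- Antipodes are contravariant functors, hence those of the members of the diagram form a cocone
with vertex the opposite of the colimit. -/
def antipodeCocone : EnrichedCocone F (ColimObj F)ᵒᵖ where
  obj := Opposite.op
  map l := S l.index l.src l.tgt ≫ letterι l.swap
  eId_map hx := ((reassoc_of% (hS _).eId_comp _) _).trans ((letterCocone F).eId_map hx)
  eComp_map hx hy hz := (hS _).eComp_comp_op ((letterCocone F).eComp_map hz hy hx)
  mapHom_map l _ f := by
    have h := (hS l.index).comp_onHom (hS _) (F.map f) (x := l.src) (y := l.tgt) rfl rfl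
    have h' := (letterCocone F).mapHom_map l.swap f
    exact ((Category.assoc _ _ _).symm.trans (congrArg (· ≫ _) h.symm)).trans
      ((Category.assoc _ _ _).trans (congrArg (_ ≫ ·) h'))

theorem isConvInverse_letterι {x z : ColimObj F} (l : Letter F x z) :
    IsConvInverse (B := ColimObj F) (letterι l) ((antipodeCocone hS).map l) := by
  obtain @⟨j, a, b, rfl, rfl⟩ := l
  have h := (isAntipode_iff.1 (hS j) a b).map ((letterCocone F).component j)
  rwa [Category.id_comp] at h

theorem isConvInverse_wordι {y x : ColimObj F} (w : Word F y x) :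
    IsConvInverse (B := ColimObj F) (wordι w) ((antipodeCocone hS).word w) := by
  induction w with
  | nil =>
    have h := IsConvInverse.convUnit (C := 𝟙_ V) (B := ColimObj F) y
    rwa [convUnit, ComonObj.instTensorUnit_counit, Category.id_comp] at h
  | snoc w l ih =>
    rw [wordι_snoc, EnrichedCocone.word_snoc, tensorHom_eComp_op_eq]
    exact ih.tensorHom_comp_eComp (isConvInverse_letterι hS l)

theorem isConvInverse_of_wordι {B : Type w} [EnrichedCategory V B] {a b : B} {y x : ColimObj F}
    {f : (y ⟶[V] x) ⟶ (a ⟶[V] b)} {g : (y ⟶[V] x) ⟶ (b ⟶[V] a)}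
    (h : ∀ w : Word F y x, IsConvInverse (B := B) (wordι w ≫ f) (wordι w ≫ g)) :
    IsConvInverse f g where
  right := colimHom_ext (𝟭 V) fun w => by
    change wordι w ≫ conv f g = wordι w ≫ convUnit _ _
    rw [comp_conv, comp_convUnit, (h w).right]
  left := colimHom_ext (𝟭 V) fun w => by
    change wordι w ≫ conv g f = wordι w ≫ convUnit _ _
    rw [comp_conv, comp_convUnit, (h w).left]

/-- The antipode of a colimit of Hopf categories. -/
def colimAntipode (y x : ColimObj F) : (y ⟶[V] x) ⟶ (x ⟶[V] y) := (antipodeCocone hS).liftHom y x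

theorem wordι_colimAntipode {y x : ColimObj F} (w : Word F y x) :
    wordι w ≫ colimAntipode hS y x = (antipodeCocone hS).word w :=
  (antipodeCocone hS).wordι_liftHom w

theorem isAntipode_colimAntipode : (colimCat F).IsAntipode (colimAntipode hS) :=
  isAntipode_iff.2 fun y x => isConvInverse_of_wordι (y := y) (x := x) fun w => by
    rw [wordι_colimAntipode]
    exact (Category.comp_id (wordι w)).symm ▸ isConvInverse_wordι hS w

end Antipode

theorem isHopf_isClosedUnderColimitsOfShape (J : Type v) [SmallCategory J] :
    (isHopf V).IsClosedUnderColimitsOfShape J where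
  colimitsOfShape_le := by
    rintro X ⟨p⟩
    choose S hS using p.prop_diag_obj
    exact (isHopf V).prop_of_iso
      ((colimCoconeIsColimit p.diag).coconePointUniqueUpToIso p.isColimit)
      ⟨_, isAntipode_colimAntipode hS⟩

end Colimits

end SemiHopfCat

/-! ### Limits of comonoids -/

theorem JointlyMonic.mono_lift {V : Type u} [Category.{v} V] {B P : V} {ι : Type v} {X : ι → V}
    {β : ∀ i, B ⟶ X i} (hβ : JointlyMonic β) (m : B ⟶ P) (π : ∀ i, P ⟶ X i)
    (h : ∀ i, m ≫ π i = β i) : Mono m where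
  right_cancellation f g w := hβ f g fun i => by rw [← h, reassoc_of% w]

namespace VeryFlatTensor

variable {V : Type u} [Category.{v} V] [MonoidalCategory V] [BraidedCategory V]

theorem jointlyMonic_whiskerLeft (hV : VeryFlatTensor V) (A : V) {B : V} {ι : Type v} [Nonempty ι]
    {X : ι → V} {β : ∀ i, B ⟶ X i} (hβ : JointlyMonic β) : JointlyMonic fun i => A ◁ β i := by
  intro W g h w
  rw [← cancel_mono (β_ A B).hom]
  refine hV A B ι X β hβ _ _ fun i => ?_
  rw [Category.assoc, Category.assoc, ← BraidedCategory.braiding_naturality_right,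
    reassoc_of% w i]

theorem jointlyMonic_tensorHom (hV : VeryFlatTensor V) {B C : V} {ι κ : Type v} [Nonempty ι]
    [Nonempty κ] {X : ι → V} {Y : κ → V} {β : ∀ i, B ⟶ X i} {γ : ∀ k, C ⟶ Y k}
    (hβ : JointlyMonic β) (hγ : JointlyMonic γ) :
    JointlyMonic fun i : ι × κ => β i.1 ⊗ₘ γ i.2 := by
  intro W g h w
  refine hV C B ι X β hβ _ _ fun i => hV.jointlyMonic_whiskerLeft (X i) hγ _ _ fun k => ?_
  simpa only [MonoidalCategory.tensorHom_def, Category.assoc] using w (i, k)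

end VeryFlatTensor

section ComulList

variable {V : Type u} [Category.{v} V] [MonoidalCategory V] {ι : Type w} (X : ι → V)

/-- The tensor product of a list of objects. The list is read from the right, so that the head
becomes the last factor. -/
def tensorList : List ι → V
  | [] => 𝟙_ V
  | j :: l => tensorList l ⊗ X j

/-- The tensor product of a concatenation. -/
def tensorListAppend (l : List ι) :
    ∀ l' : List ι, tensorList X l ⊗ tensorList X l' ≅ tensorList X (l' ++ l)
  | [] => ρ_ _
  | j :: l' => (α_ _ _ _).symm ≪≫ whiskerRightIso (tensorListAppend l l') (X j)

/-- The tensor product of a list with one element. -/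
def tensorListSingleton (j : ι) : tensorList X [j] ≅ X j := λ_ (X j)

variable {X} {C D : V} [ComonObj C] [ComonObj D]

/-- The iterated comultiplication of a comonoid followed by a list of morphisms. -/
def comulList (p : ∀ j, C ⟶ X j) : ∀ l : List ι, C ⟶ tensorList X l
  | [] => ε[C]
  | j :: l => Δ[C] ≫ (comulList p l ⊗ₘ p j)

theorem comulList_singleton (p : ∀ j, C ⟶ X j) (j : ι) :
    comulList p [j] ≫ (tensorListSingleton X j).hom = p j := by
  change (Δ[C] ≫ (ε[C] ⊗ₘ p j)) ≫ (λ_ (X j)).hom = p j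
  rw [ComonObj.counit_comul_hom, Category.assoc, Iso.inv_hom_id, Category.comp_id]

theorem comp_comulList (f : C ⟶ D) [IsComonHom f] (p : ∀ j, D ⟶ X j) (l : List ι) :
    f ≫ comulList p l = comulList (fun j => f ≫ p j) l := by
  induction l with
  | nil => exact IsComonHom.hom_counit f
  | cons j l ih =>
    change f ≫ Δ[D] ≫ (comulList p l ⊗ₘ p j) =
      Δ[C] ≫ (comulList (fun j => f ≫ p j) l ⊗ₘ (f ≫ p j))
    rw [IsComonHom.hom_comul_assoc, tensorHom_comp_tensorHom, ih]

theorem comp_comulList_eq {C D : V} [ComonObj D] {p : ∀ j, D ⟶ X j} {g h : C ⟶ D}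
    (hε : g ≫ ε[D] = h ≫ ε[D])
    (hΔ : ∀ {Z Z' : V} (q : D ⟶ Z) (q' : D ⟶ Z'), g ≫ q = h ≫ q → g ≫ q' = h ≫ q' →
      g ≫ Δ[D] ≫ (q ⊗ₘ q') = h ≫ Δ[D] ≫ (q ⊗ₘ q'))
    (hp : ∀ j, g ≫ p j = h ≫ p j) (l : List ι) : g ≫ comulList p l = h ≫ comulList p l := by
  induction l with
  | nil => exact hε
  | cons j l ih => exact hΔ (comulList p l) (p j) ih (hp j)

theorem comul_comulList_tensorListAppend (p : ∀ j, C ⟶ X j) (l l' : List ι) :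
    Δ[C] ≫ (comulList p l ⊗ₘ comulList p l') ≫ (tensorListAppend X l l').hom =
      comulList p (l' ++ l) := by
  induction l' with
  | nil =>
    change Δ[C] ≫ (comulList p l ⊗ₘ ε[C]) ≫ (ρ_ _).hom = comulList p l
    rw [← Category.assoc, ComonObj.comul_counit_hom, Category.assoc, Iso.inv_hom_id,
      Category.comp_id]
  | cons j l' ih =>
    change Δ[C] ≫ (comulList p l ⊗ₘ (Δ[C] ≫ (comulList p l' ⊗ₘ p j))) ≫ (α_ _ _ _).inv ≫
      (tensorListAppend X l l').hom ▷ X j = Δ[C] ≫ (comulList p (l' ++ l) ⊗ₘ p j)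
    have h₁ : comulList p l ⊗ₘ (Δ[C] ≫ (comulList p l' ⊗ₘ p j)) =
        C ◁ Δ[C] ≫ (comulList p l ⊗ₘ (comulList p l' ⊗ₘ p j)) := by
      rw [← id_tensorHom, tensorHom_comp_tensorHom, Category.id_comp]
    have h₂ : (Δ[C] ≫ (comulList p l ⊗ₘ comulList p l') ≫ (tensorListAppend X l l').hom) ⊗ₘ p j =
        Δ[C] ▷ C ≫ ((comulList p l ⊗ₘ comulList p l') ⊗ₘ p j) ≫
          (tensorListAppend X l l').hom ▷ X j := by
      rw [← tensorHom_id, ← tensorHom_id, tensorHom_comp_tensorHom, tensorHom_comp_tensorHom,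
        Category.id_comp, Category.comp_id]
    rw [← ih, h₁, h₂, Category.assoc, ComonObj.comul_assoc_assoc, ← associator_naturality_assoc,
      Iso.hom_inv_id_assoc]

theorem comul_tensorHom_comulList (p : ∀ j, C ⟶ X j) (l l' : List ι) :
    Δ[C] ≫ (comulList p l ⊗ₘ comulList p l') =
      comulList p (l' ++ l) ≫ (tensorListAppend X l l').inv := by
  rw [← comul_comulList_tensorListAppend, Category.assoc, Category.assoc, Iso.hom_inv_id,
    Category.comp_id]

end ComulList

section Separating

variable {V : Type u} [Category.{v} V] [MonoidalCategory V] {ι : Type v} {X : ι → V} {C D : V}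
  [ComonObj C] [ComonObj D]

/-- A family of morphisms out of a comonoid is separating if its composites with the iterated
comultiplications are jointly monic. This makes it jointly monic for comonoid morphisms, and
allows one to test on it whether a morphism preserves the comultiplications. -/
def IsSeparating (p : ∀ j, D ⟶ X j) : Prop :=
  JointlyMonic (comulList p)

namespace IsSeparating

theorem hom_ext {p : ∀ j, D ⟶ X j} (hp : IsSeparating p) (f g : C ⟶ D) [IsComonHom f]
    [IsComonHom g] (h : ∀ j, f ≫ p j = g ≫ p j) : f = g :=
  hp f g fun l => by simp only [comp_comulList, h]

theorem isComonHom [BraidedCategory V] (hV : VeryFlatTensor V) {p : ∀ j, D ⟶ X j}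
    (hp : IsSeparating p) {q : ∀ j, C ⟶ X j} (f : C ⟶ D)
    (hf : ∀ l, f ≫ comulList p l = comulList q l) : IsComonHom f where
  hom_counit := hf []
  hom_comul := hV.jointlyMonic_tensorHom hp hp _ _ fun l => by
    simp only [Category.assoc, tensorHom_comp_tensorHom, hf, comul_tensorHom_comulList]
    rw [← Category.assoc, hf]

end IsSeparating

end Separating

section Quotient

variable {V : Type u} [Category.{v} V] [MonoidalCategory V] {D E : V} [ComonObj D]

/-- The comonoid structure induced on a quotient of a comonoid. -/
abbrev quotientComon (e : D ⟶ E) [Epi e] (c : E ⟶ 𝟙_ V) (d : E ⟶ E ⊗ E) (hc : e ≫ c = ε[D])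
    (hd : e ≫ d = Δ[D] ≫ (e ⊗ₘ e)) : ComonObj E where
  counit := c
  comul := d
  counit_comul := by
    rw [← cancel_epi e, ← Category.assoc, hd, Category.assoc, ← tensorHom_id,
      tensorHom_comp_tensorHom, hc, Category.comp_id, ComonObj.counit_comul_hom]
  comul_counit := by
    rw [← cancel_epi e, ← Category.assoc, hd, Category.assoc, ← id_tensorHom,
      tensorHom_comp_tensorHom, hc, Category.comp_id, ComonObj.comul_counit_hom]
  comul_assoc := by
    have h₁ : e ⊗ₘ (Δ[D] ≫ (e ⊗ₘ e)) = D ◁ Δ[D] ≫ (e ⊗ₘ (e ⊗ₘ e)) := by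
      rw [← id_tensorHom, tensorHom_comp_tensorHom, Category.id_comp]
    have h₂ : (Δ[D] ≫ (e ⊗ₘ e)) ⊗ₘ e = Δ[D] ▷ D ≫ ((e ⊗ₘ e) ⊗ₘ e) := by
      rw [← tensorHom_id, tensorHom_comp_tensorHom, Category.id_comp]
    rw [← cancel_epi e, reassoc_of% hd, reassoc_of% hd, ← id_tensorHom, ← tensorHom_id,
      tensorHom_comp_tensorHom, tensorHom_comp_tensorHom_assoc, hd, Category.comp_id, h₁, h₂,
      ComonObj.comul_assoc_assoc, Category.assoc, associator_naturality]

theorem isComonHom_of_epi_comp {F : V} [ComonObj E] [ComonObj F] (e : D ⟶ E) [Epi e]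
    [IsComonHom e] (f : E ⟶ F) [IsComonHom (e ≫ f)] : IsComonHom f where
  hom_counit := by
    rw [← cancel_epi e, ← Category.assoc, IsComonHom.hom_counit, IsComonHom.hom_counit]
  hom_comul := by
    rw [← cancel_epi e, ← Category.assoc, IsComonHom.hom_comul, IsComonHom.hom_comul_assoc,
      tensorHom_comp_tensorHom]

-- `E` is the image of `D` in the product of the `tensorList X l`; its comultiplication is a
-- diagonal filler, as `E ⊗ E` is a subobject of a product by very flatness.
theorem exists_isSeparating_quotient [BraidedCategory V] [HasLimits V] [WellPowered.{v} V]
    (hV : VeryFlatTensor V) {ι : Type v} {X : ι → V} (p : ∀ j, D ⟶ X j) :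
    ∃ (E : V) (_ : ComonObj E) (e : D ⟶ E) (q : ∀ j, E ⟶ X j),
      Epi e ∧ IsComonHom e ∧ (∀ j, e ≫ q j = p j) ∧ IsSeparating q := by
  let E : V := image (Pi.lift (comulList p))
  let e : D ⟶ E := factorThruImage _
  let m : E ⟶ ∏ᶜ tensorList X := image.ι _
  have : StrongEpi e := inferInstance
  let w : ∀ l, E ⟶ tensorList X l := fun l => m ≫ Pi.π _ l
  have e_w : ∀ l, e ≫ w l = comulList p l := fun l => by
    rw [← Category.assoc, image.fac, Pi.lift_π]
  have hw : JointlyMonic w := fun W f g h => by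
    rw [← cancel_mono m]
    exact Pi.hom_ext _ _ fun l => by simpa only [w, Category.assoc] using h l
  let n : E ⊗ E ⟶ ∏ᶜ fun l : List ι × List ι => tensorList X l.1 ⊗ tensorList X l.2 :=
    Pi.lift fun l => w l.1 ⊗ₘ w l.2
  have : Mono n := (hV.jointlyMonic_tensorHom hw hw).mono_lift n (fun l => Pi.π _ l)
    fun l => Pi.lift_π _ _
  have sq : CommSq (Δ[D] ≫ (e ⊗ₘ e)) e n
      (Pi.lift fun l => w (l.2 ++ l.1) ≫ (tensorListAppend X l.1 l.2).inv) :=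
    ⟨Pi.hom_ext _ _ fun l => by
      simp only [n, Category.assoc, Pi.lift_π, tensorHom_comp_tensorHom, e_w, reassoc_of% e_w,
        comul_tensorHom_comulList]⟩
  have : sq.HasLift := inferInstance
  let : ComonObj E := quotientComon e (w []) sq.lift (e_w []) sq.fac_left
  have : IsComonHom e := ⟨e_w [], sq.fac_left⟩
  let q : ∀ j, E ⟶ X j := fun j => w [j] ≫ (tensorListSingleton X j).hom
  have e_q : ∀ j, e ≫ q j = p j := fun j => by
    rw [reassoc_of% e_w, comulList_singleton]
  have comulList_q : comulList q = w := by
    funext l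
    rw [← cancel_epi e, e_w, comp_comulList]
    simp only [e_q]
  exact ⟨E, _, e, q, inferInstance, inferInstance, e_q, by rwa [IsSeparating, comulList_q]⟩

end Quotient

section ComonLimits

variable {V : Type u} [Category.{v} V] [MonoidalCategory V] {J : Type v} [SmallCategory J]
  {X : J ⥤ Comon V}

/-- The components of a cone of comonoids, as a family of morphisms of `V`. -/
abbrev legs (D : Cone X) (j : J) : D.pt.X ⟶ (X.obj j).X :=
  (D.π.app j).hom

theorem coneHom_comulList {D E : Cone X} (f : D ⟶ E) (l : List J) :
    f.hom.hom ≫ comulList (legs E) l = comulList (legs D) l := by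
  rw [comp_comulList]
  exact congrArg (comulList · l) (funext fun j => congrArg Comon.Hom.hom (f.w j))

variable [BraidedCategory V]

theorem nonempty_coneHom_of_comp_comulList (hV : VeryFlatTensor V) {D E : Cone X}
    (hE : IsSeparating (legs E)) (i : D.pt.X ⟶ E.pt.X)
    (hi : ∀ l, i ≫ comulList (legs E) l = comulList (legs D) l) : Nonempty (D ⟶ E) := by
  have : IsComonHom i := hE.isComonHom hV i hi
  refine ⟨⟨Comon.Hom.mk i, fun j => Comon.Hom.ext ?_⟩⟩
  change i ≫ legs E j = legs D j
  rw [← comulList_singleton (legs D), ← hi, Category.assoc, comulList_singleton]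

variable [HasLimits V] [WellPowered.{v} V]

theorem exists_isSeparating_cone (hV : VeryFlatTensor V) (D : Cone X) :
    ∃ E : Cone X, IsSeparating (legs E) ∧ Nonempty (D ⟶ E) := by
  obtain ⟨E, _, e, q, _, _, e_q, hq⟩ :=
    exists_isSeparating_quotient hV (legs D)
  have (j : J) : IsComonHom (q j) :=
    have : IsComonHom (e ≫ q j) := e_q j ▸ inferInstance
    isComonHom_of_epi_comp e (q j)
  refine ⟨⟨Comon.mk E, { app := fun j => Comon.Hom.mk (q j), naturality := fun j k f => ?_ }⟩, hq,
    ⟨⟨Comon.Hom.mk e, fun j => Comon.Hom.ext (e_q j)⟩⟩⟩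
  refine (Category.id_comp _).trans (Comon.Hom.ext ?_)
  change q k = q j ≫ (X.map f).hom
  rw [← cancel_epi e, reassoc_of% e_q, e_q, legs, ← D.w f]
  rfl

-- A separating cone is determined by its apex as a subobject of the product of all the tensor
-- products of lists.
theorem exists_small_weaklyTerminal_isSeparating (hV : VeryFlatTensor V) (X : J ⥤ Comon V) :
    ∃ (T : Type v) (E : T → Cone X), ∀ D : Cone X, IsSeparating (legs D) →
      ∃ t, Nonempty (D ⟶ E t) := by
  let P : V := ∏ᶜ tensorList fun j => (X.obj j).X
  let toP (D : Cone X) : D.pt.X ⟶ P := Pi.lift (comulList (legs D))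
  have mono_toP {D : Cone X} (hD : IsSeparating (legs D)) : Mono (toP D) :=
    hD.mono_lift _ (Pi.π _) fun _ => Pi.lift_π _ _
  let T := {s : Subobject P // ∃ (D : Cone X) (hD : IsSeparating (legs D)),
    haveI := mono_toP hD; Subobject.mk (toP D) = s}
  have : Small.{v} (Subobject P) := WellPowered.subobject_small _
  have : Small.{v} T := small_subtype _ _
  choose E hE mk_E using fun t : T => t.2
  refine ⟨Shrink.{v} T, fun t => E ((equivShrink T).symm t), fun D hD => ?_⟩
  have := mono_toP hD
  obtain ⟨t, ht⟩ := (equivShrink T).symm.surjective ⟨Subobject.mk (toP D), D, hD, rfl⟩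
  let E' : Cone X := E ((equivShrink T).symm t)
  have := mono_toP (hE ((equivShrink T).symm t))
  have mk_E' : Subobject.mk (toP D) = Subobject.mk (toP E') :=
    (congrArg Subtype.val ht).symm.trans (mk_E _).symm
  let i : D.pt.X ⟶ E'.pt.X := Subobject.ofMkLEMk (toP D) (toP E') mk_E'.le
  have i_toP : i ≫ toP E' = toP D := Subobject.ofMkLEMk_comp _
  exact ⟨t, nonempty_coneHom_of_comp_comulList hV (hE _) i fun l => by
    simpa only [toP, Category.assoc, Pi.lift_π] using i_toP =≫ Pi.π _ l⟩

variable [HasColimits V]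

theorem exists_isSeparating_isLimit (hV : VeryFlatTensor V) (X : J ⥤ Comon V) :
    ∃ L : Cone X, IsSeparating (legs L) ∧ Nonempty (IsLimit L) := by
  obtain ⟨T, E, hE⟩ := exists_small_weaklyTerminal_isSeparating hV X
  let S : Cone X :=
    { pt := ∐ fun t => (E t).pt
      π := { app := fun j => Sigma.desc fun t => (E t).π.app j
             naturality := fun j k f => Sigma.hom_ext _ _ fun t => by simp } }
  have toS (t : T) : E t ⟶ S := ⟨Sigma.ι (fun t => (E t).pt) t, fun j => Sigma.ι_desc _ _⟩
  obtain ⟨L, hL, ⟨q⟩⟩ := exists_isSeparating_cone hV S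
  have exists_lift (D : Cone X) : Nonempty (D ⟶ L) := by
    obtain ⟨D', hD', ⟨e⟩⟩ := exists_isSeparating_cone hV D
    obtain ⟨t, ⟨i⟩⟩ := hE D' hD'
    exact ⟨e ≫ i ≫ toS t ≫ q⟩
  refine ⟨L, hL, ⟨⟨fun D => (exists_lift D).some.hom, fun D => (exists_lift D).some.w, ?_⟩⟩⟩
  intro D f hf
  refine Comon.Hom.ext (hL.hom_ext _ _ fun j => ?_)
  exact congrArg Comon.Hom.hom ((hf j).trans ((exists_lift D).some.w j).symm)

theorem hasLimitsOfShape_comon (hV : VeryFlatTensor V) : HasLimitsOfShape J (Comon V) where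
  has_limit X :=
    have ⟨_, _, ⟨hL⟩⟩ := exists_isSeparating_isLimit hV X
    ⟨⟨⟨_, hL⟩⟩⟩

theorem isSeparating_of_isLimit (hV : VeryFlatTensor V) {c : Cone X} (hc : IsLimit c) :
    IsSeparating (legs c) := by
  obtain ⟨L, hL, ⟨hL'⟩⟩ := exists_isSeparating_isLimit hV X
  let e : c ≅ L := hc.uniqueUpToIso hL'
  intro W f g h
  have : Mono e.hom.hom.hom :=
    inferInstanceAs (Mono ((Cone.forget X ⋙ Comon.forget V).map e.hom))
  rw [← cancel_mono e.hom.hom.hom]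
  refine hL _ _ fun l => ?_
  rw [Category.assoc, Category.assoc, coneHom_comulList, h]

end ComonLimits

/-! ### Limits of semi-Hopf categories -/

section CoOpposite

variable {V : Type u} [Category.{v} V] [MonoidalCategory V] [BraidedCategory V] {C D : V}

variable (C) in
/-- The co-opposite of a comonoid, whose comultiplication is followed by the braiding. -/
abbrev copComon [ComonObj C] : ComonObj C where
  counit := ε[C]
  comul := Δ[C] ≫ (β_ C C).hom
  counit_comul := by
    rw [Category.assoc, ← BraidedCategory.braiding_naturality_right, ComonObj.comul_counit_assoc,
      braiding_tensorUnit_right, Iso.inv_hom_id_assoc]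
  comul_counit := by
    rw [Category.assoc, ← BraidedCategory.braiding_naturality_left, ComonObj.counit_comul_assoc,
      braiding_tensorUnit_left, Iso.inv_hom_id_assoc]
  comul_assoc := by
    have h := BraidedCategory.yang_baxter C C C
    rw [Category.assoc, Category.assoc, ← BraidedCategory.braiding_naturality_left,
      ← BraidedCategory.braiding_naturality_right_assoc, comp_whiskerRight,
      MonoidalCategory.whiskerLeft_comp, Category.assoc, Category.assoc,
      ComonObj.comul_assoc_assoc, BraidedCategory.braiding_tensor_left_hom,
      BraidedCategory.braiding_tensor_right_hom]
    simp only [Category.assoc, Iso.inv_hom_id, Category.comp_id] at h ⊢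
    rw [Iso.inv_comp_eq] at h
    rw [h]

theorem isComonHom_copComon [ComonObj C] [ComonObj D] (f : C ⟶ D) (h : f ≫ ε[D] = ε[C])
    (h' : f ≫ Δ[D] = Δ[C] ≫ (β_ C C).hom ≫ (f ⊗ₘ f)) :
    letI := copComon C
    IsComonHom f :=
  letI := copComon C
  ⟨h, h'.trans (Category.assoc _ _ _).symm⟩

end CoOpposite

section NestedInverse

variable {V : Type u} [Category.{v} V] [MonoidalCategory V] [BraidedCategory V]

theorem whiskerLeft_braiding_tensorμ (X X' Y Y' : V) :
    (X ⊗ X') ◁ (β_ Y' Y).hom ≫ tensorμ X X' Y Y' =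
      (α_ X X' (Y' ⊗ Y)).hom ≫ X ◁ ((α_ X' Y' Y).inv ≫ (β_ (X' ⊗ Y') Y).hom) ≫
        (α_ X Y (X' ⊗ Y')).inv := by
  rw [tensorμ, BraidedCategory.braiding_tensor_left_hom]
  monoidal

theorem braiding_whiskerRight_tensorμ (X X' Y Y' : V) :
    (β_ X X').hom ▷ (Y ⊗ Y') ≫ tensorμ X' X Y Y' =
      (α_ (X ⊗ X') Y Y').inv ≫ ((α_ X X' Y).hom ≫ (β_ X (X' ⊗ Y)).hom) ▷ Y' ≫
        (α_ (X' ⊗ Y) X Y').hom := by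
  rw [tensorμ, BraidedCategory.braiding_tensor_right_hom]
  monoidal

variable {C : V} [ComonObj C] {Z Z' : V} {m : C ⊗ C ⟶ Z} {m' : C ⊗ C ⟶ Z'} {e : 𝟙_ V ⟶ Z}
  {e' : 𝟙_ V ⟶ Z'}

-- In Sweedler notation the left hand side is `m (c₁ ⊗ c₄) ⊗ m' (c₂ ⊗ c₃)`: the inner factor
-- collapses first, and then the outer one.
theorem comul_comul_braiding_tensorμ (hm : Δ[C] ≫ m = ε[C] ≫ e) (hm' : Δ[C] ≫ m' = ε[C] ≫ e') :
    Δ[C] ≫ (Δ[C] ⊗ₘ (Δ[C] ≫ (β_ C C).hom)) ≫ tensorμ C C C C ≫ (m ⊗ₘ m') =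
      ε[C] ≫ (λ_ (𝟙_ V)).inv ≫ (e ⊗ₘ e') := by
  have nest : Δ[C] ≫ (Δ[C] ⊗ₘ (Δ[C] ≫ (β_ C C).hom)) ≫ tensorμ C C C C =
      Δ[C] ≫ C ◁ (Δ[C] ≫ Δ[C] ▷ C ≫ (β_ (C ⊗ C) C).hom) ≫ (α_ C C (C ⊗ C)).inv := by
    rw [MonoidalCategory.tensorHom_def, MonoidalCategory.whiskerLeft_comp, Category.assoc,
      Category.assoc, whiskerLeft_braiding_tensorμ, associator_naturality_right_assoc,
      ← ComonObj.comul_assoc_assoc, ← MonoidalCategory.whiskerLeft_comp_assoc,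
      ← MonoidalCategory.whiskerLeft_comp_assoc, Category.assoc,
      ComonObj.comul_assoc_flip_assoc]
  have inner : Δ[C] ≫ Δ[C] ▷ C ≫ (β_ (C ⊗ C) C).hom ≫ C ◁ m' = (ρ_ C).inv ≫ C ◁ e' := by
    rw [← BraidedCategory.braiding_naturality_left, ← comp_whiskerRight_assoc, hm',
      comp_whiskerRight_assoc, ComonObj.counit_comul_assoc,
      BraidedCategory.braiding_naturality_left]
    simp
  calc
    _ = Δ[C] ≫ C ◁ (Δ[C] ≫ Δ[C] ▷ C ≫ (β_ (C ⊗ C) C).hom ≫ C ◁ m') ≫ (α_ C C Z').inv ≫ m ▷ Z' := by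
      rw [reassoc_of% nest, MonoidalCategory.tensorHom_def',
        ← associator_inv_naturality_right_assoc]
      simp only [MonoidalCategory.whiskerLeft_comp, Category.assoc]
    _ = Δ[C] ≫ m ≫ (ρ_ Z).inv ≫ Z ◁ e' := by
      rw [inner, MonoidalCategory.whiskerLeft_comp, Category.assoc,
        associator_inv_naturality_right_assoc, whisker_exchange,
        ← MonoidalCategory.rightUnitor_tensor_inv_assoc, ← rightUnitor_inv_naturality_assoc]
    _ = ε[C] ≫ (λ_ (𝟙_ V)).inv ≫ (e ⊗ₘ e') := by
      rw [reassoc_of% hm, unitors_inv_equal, MonoidalCategory.tensorHom_def,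
        rightUnitor_inv_naturality_assoc]

-- In Sweedler notation the left hand side is `m (c₂ ⊗ c₃) ⊗ m' (c₁ ⊗ c₄)`.
theorem comul_braiding_comul_tensorμ (hm : Δ[C] ≫ m = ε[C] ≫ e) (hm' : Δ[C] ≫ m' = ε[C] ≫ e') :
    Δ[C] ≫ ((Δ[C] ≫ (β_ C C).hom) ⊗ₘ Δ[C]) ≫ tensorμ C C C C ≫ (m ⊗ₘ m') =
      ε[C] ≫ (λ_ (𝟙_ V)).inv ≫ (e ⊗ₘ e') := by
  have nest : Δ[C] ≫ ((Δ[C] ≫ (β_ C C).hom) ⊗ₘ Δ[C]) ≫ tensorμ C C C C =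
      Δ[C] ≫ (Δ[C] ≫ C ◁ Δ[C] ≫ (β_ C (C ⊗ C)).hom) ▷ C ≫ (α_ (C ⊗ C) C C).hom := by
    rw [MonoidalCategory.tensorHom_def', comp_whiskerRight, Category.assoc, Category.assoc,
      braiding_whiskerRight_tensorμ, associator_inv_naturality_left_assoc,
      ← ComonObj.comul_assoc_flip_assoc, ← comp_whiskerRight_assoc, ← comp_whiskerRight_assoc,
      Category.assoc, ← ComonObj.comul_assoc_assoc]
  have inner : Δ[C] ≫ C ◁ Δ[C] ≫ (β_ C (C ⊗ C)).hom ≫ m ▷ C = (λ_ C).inv ≫ e ▷ C := by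
    rw [← BraidedCategory.braiding_naturality_right, ← MonoidalCategory.whiskerLeft_comp_assoc, hm,
      MonoidalCategory.whiskerLeft_comp_assoc, ComonObj.comul_counit_assoc,
      BraidedCategory.braiding_naturality_right]
    simp
  calc
    _ = Δ[C] ≫ (Δ[C] ≫ C ◁ Δ[C] ≫ (β_ C (C ⊗ C)).hom ≫ m ▷ C) ▷ C ≫ (α_ Z C C).hom ≫ Z ◁ m' := by
      rw [reassoc_of% nest, MonoidalCategory.tensorHom_def, ← associator_naturality_left_assoc]
      simp only [comp_whiskerRight, Category.assoc]
    _ = Δ[C] ≫ m' ≫ (λ_ Z').inv ≫ e ▷ Z' := by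
      rw [inner, comp_whiskerRight, Category.assoc, associator_naturality_left_assoc,
        ← whisker_exchange, ← MonoidalCategory.leftUnitor_tensor_inv_assoc,
        ← leftUnitor_inv_naturality_assoc]
    _ = ε[C] ≫ (λ_ (𝟙_ V)).inv ≫ (e ⊗ₘ e') := by
      rw [reassoc_of% hm', MonoidalCategory.tensorHom_def', leftUnitor_inv_naturality_assoc]

end NestedInverse

/-- The objects of the product of two enriched categories, whose Hom-objects are the tensor
products of the Hom-objects of the factors. -/
structure EnrichedProd (A : Type w) (B : Type w') where
  fst : A
  snd : B

section EnrichedProd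

variable {V : Type u} [Category.{v} V] [MonoidalCategory V] [BraidedCategory V]
  {A : Type w} {B : Type w'} [EnrichedCategory V A] [EnrichedCategory V B]

instance : EnrichedCategory V (EnrichedProd A B) where
  Hom x y := (x.fst ⟶[V] y.fst) ⊗ (x.snd ⟶[V] y.snd)
  id x := (λ_ _).inv ≫ (eId V x.fst ⊗ₘ eId V x.snd)
  comp x y z := tensorμ _ _ _ _ ≫ (eComp V _ _ _ ⊗ₘ eComp V _ _ _)
  id_comp x y := by
    rw [Iso.inv_comp_eq, Category.comp_id, tensor_left_unitality, comp_whiskerRight,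
      Category.assoc, tensorμ_natural_left_assoc, tensorHom_comp_tensorHom,
      ← (Iso.inv_comp_eq_id _).1 (e_id_comp V x.fst y.fst),
      ← (Iso.inv_comp_eq_id _).1 (e_id_comp V x.snd y.snd)]
  comp_id x y := by
    rw [Iso.inv_comp_eq, Category.comp_id, tensor_right_unitality,
      MonoidalCategory.whiskerLeft_comp, Category.assoc, tensorμ_natural_right_assoc,
      tensorHom_comp_tensorHom, ← (Iso.inv_comp_eq_id _).1 (e_comp_id V x.fst y.fst),
      ← (Iso.inv_comp_eq_id _).1 (e_comp_id V x.snd y.snd)]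
  assoc x y z t := by
    rw [Iso.inv_comp_eq, comp_whiskerRight, Category.assoc, tensorμ_natural_left_assoc,
      tensorHom_comp_tensorHom, ← e_assoc', ← e_assoc', ← tensorHom_comp_tensorHom,
      reassoc_of% @tensor_associativity, MonoidalCategory.whiskerLeft_comp, Category.assoc,
      tensorμ_natural_right_assoc, tensorHom_comp_tensorHom]

theorem IsConvInverse.prod {C : V} [ComonObj C] {x y : A} {x' y' : B} {f : C ⟶ (x ⟶[V] y)}
    {g : C ⟶ (y ⟶[V] x)} {f' : C ⟶ (x' ⟶[V] y')} {g' : C ⟶ (y' ⟶[V] x')}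
    (h : IsConvInverse f g) (h' : IsConvInverse f' g') :
    IsConvInverse (B := EnrichedProd A B) (x := ⟨x, x'⟩) (y := ⟨y, y'⟩)
      (Δ[C] ≫ (f ⊗ₘ f')) (Δ[C] ≫ (β_ C C).hom ≫ (g ⊗ₘ g')) where
  right := by
    refine Eq.trans ?_ (comul_comul_braiding_tensorμ h.right h'.right)
    change Δ[C] ≫ (_ ⊗ₘ _) ≫ tensorμ _ _ _ _ ≫ (_ ⊗ₘ _) = _
    rw [← Category.assoc Δ[C] (β_ C C).hom, ← tensorHom_comp_tensorHom, Category.assoc,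
      tensorμ_natural_assoc, tensorHom_comp_tensorHom]
  left := by
    refine Eq.trans ?_ (comul_braiding_comul_tensorμ h.left h'.left)
    change Δ[C] ≫ (_ ⊗ₘ _) ≫ tensorμ _ _ _ _ ≫ (_ ⊗ₘ _) = _
    rw [← Category.assoc Δ[C] (β_ C C).hom, ← tensorHom_comp_tensorHom, Category.assoc,
      tensorμ_natural_assoc, tensorHom_comp_tensorHom]

end EnrichedProd

namespace SemiHopfCat

variable {V : Type u} [Category.{v} V] [MonoidalCategory V] [BraidedCategory V]

/-- The comultiplications of a semi-Hopf category as a `V`-functor. -/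
def comulFunctor (A : SemiHopfCat V) :
    EnrichedFunctor V A.carrier (EnrichedProd A.carrier A.carrier) where
  obj x := ⟨x, x⟩
  map x y := Δ[x ⟶[V] y]
  map_id := A.id_comul
  map_comp := A.comp_comul

namespace IsAntipode

variable {A : SemiHopfCat V} {S : ∀ x y : A.carrier, (x ⟶[V] y) ⟶ (y ⟶[V] x)}

theorem comp_comul (hS : A.IsAntipode S) (x y : A.carrier) :
    S x y ≫ Δ[y ⟶[V] x] = Δ[x ⟶[V] y] ≫ (β_ _ _).hom ≫ (S x y ⊗ₘ S x y) := by
  have h := isAntipode_iff.1 hS x y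
  have h₁ := h.map A.comulFunctor
  have h₂ := h.prod h
  rw [id_tensorHom_id, Category.comp_id] at h₂
  rw [Category.id_comp] at h₁
  exact h₁.unique h₂

theorem comp_counit (hS : A.IsAntipode S) (x y : A.carrier) :
    S x y ≫ ε[y ⟶[V] x] = ε[x ⟶[V] y] := by
  have h := (isAntipode_iff.1 hS x y).right =≫ ε
  simp only [conv, convUnit, Category.assoc, A.comp_counit, A.id_counit, Category.comp_id,
    tensorHom_comp_tensorHom_assoc, Category.id_comp] at h
  rwa [ComonObj.counit_comul_hom_assoc, Iso.inv_hom_id, Category.comp_id] at h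

end IsAntipode

section

variable {A : SemiHopfCat V} {x y : A.carrier} {s : (x ⟶[V] y) ⟶ (y ⟶[V] x)}

theorem convUnit_counit (C : V) [ComonObj C] (x : A.carrier) :
    convUnit C x ≫ ε[x ⟶[V] x] = ε[C] := by
  rw [convUnit, Category.assoc, A.id_counit, Category.comp_id]

theorem conv_counit {C : V} [ComonObj C] {x y z : A.carrier} {f : C ⟶ (x ⟶[V] y)}
    {g : C ⟶ (y ⟶[V] z)} (hf : f ≫ ε = ε[C]) (hg : g ≫ ε = ε[C]) :
    conv f g ≫ ε[x ⟶[V] z] = ε[C] := by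
  rw [conv, Category.assoc, Category.assoc, A.comp_counit, tensorHom_comp_tensorHom_assoc, hf, hg,
    ComonObj.counit_comul_hom_assoc, Iso.inv_hom_id, Category.comp_id]

theorem convUnit_comul {C : V} [ComonObj C] (x : A.carrier) {Z Z' : V} (q : (x ⟶[V] x) ⟶ Z)
    (q' : (x ⟶[V] x) ⟶ Z') :
    convUnit C x ≫ Δ[x ⟶[V] x] ≫ (q ⊗ₘ q') =
      ε[C] ≫ (λ_ (𝟙_ V)).inv ≫ ((eId V x ≫ q) ⊗ₘ (eId V x ≫ q')) := by
  rw [convUnit, Category.assoc, reassoc_of% A.id_comul x, tensorHom_comp_tensorHom]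

theorem conv_comul {C : V} [ComonObj C] {x y z : A.carrier} (f : C ⟶ (x ⟶[V] y))
    (g : C ⟶ (y ⟶[V] z)) {Z Z' : V} (q : (x ⟶[V] z) ⟶ Z) (q' : (x ⟶[V] z) ⟶ Z') :
    conv f g ≫ Δ[x ⟶[V] z] ≫ (q ⊗ₘ q') =
      Δ[C] ≫ ((f ≫ Δ) ⊗ₘ (g ≫ Δ)) ≫ tensorμ _ _ _ _ ≫
        ((eComp V x y z ≫ q) ⊗ₘ (eComp V x y z ≫ q')) := by
  simp only [conv, Category.assoc, reassoc_of% A.comp_comul, tensorHom_comp_tensorHom,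
    tensorHom_comp_tensorHom_assoc]

theorem conv_id_comul (hs : s ≫ Δ = Δ ≫ (β_ _ _).hom ≫ (s ⊗ₘ s)) {Z Z' : V}
    {q : (x ⟶[V] x) ⟶ Z} {q' : (x ⟶[V] x) ⟶ Z'} (hq : conv (𝟙 _) s ≫ q = convUnit _ x ≫ q)
    (hq' : conv (𝟙 _) s ≫ q' = convUnit _ x ≫ q') :
    conv (𝟙 _) s ≫ Δ[x ⟶[V] x] ≫ (q ⊗ₘ q') = convUnit _ x ≫ Δ[x ⟶[V] x] ≫ (q ⊗ₘ q') := by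
  have hs' : Δ ⊗ₘ (s ≫ Δ) = (Δ ⊗ₘ (Δ ≫ (β_ _ _).hom)) ≫ ((𝟙 (x ⟶[V] y) ⊗ₘ 𝟙 _) ⊗ₘ (s ⊗ₘ s)) := by
    rw [hs, tensorHom_comp_tensorHom, id_tensorHom_id, Category.comp_id, Category.assoc]
  simp only [conv, convUnit, Category.assoc] at hq hq'
  rw [convUnit_comul, ← comul_comul_braiding_tensorμ hq hq', conv_comul, Category.id_comp, hs',
    Category.assoc, tensorμ_natural_assoc, tensorHom_comp_tensorHom]

theorem conv_comul_id (hs : s ≫ Δ = Δ ≫ (β_ _ _).hom ≫ (s ⊗ₘ s)) {Z Z' : V}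
    {q : (y ⟶[V] y) ⟶ Z} {q' : (y ⟶[V] y) ⟶ Z'} (hq : conv s (𝟙 _) ≫ q = convUnit _ y ≫ q)
    (hq' : conv s (𝟙 _) ≫ q' = convUnit _ y ≫ q') :
    conv s (𝟙 _) ≫ Δ[y ⟶[V] y] ≫ (q ⊗ₘ q') = convUnit _ y ≫ Δ[y ⟶[V] y] ≫ (q ⊗ₘ q') := by
  have hs' : (s ≫ Δ) ⊗ₘ Δ = ((Δ ≫ (β_ _ _).hom) ⊗ₘ Δ) ≫ ((s ⊗ₘ s) ⊗ₘ (𝟙 (x ⟶[V] y) ⊗ₘ 𝟙 _)) := by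
    rw [hs, tensorHom_comp_tensorHom, id_tensorHom_id, Category.comp_id, Category.assoc]
  simp only [conv, convUnit, Category.assoc] at hq hq'
  rw [convUnit_comul, ← comul_braiding_comul_tensorμ hq hq', conv_comul, Category.id_comp, hs',
    Category.assoc, tensorμ_natural_assoc, tensorHom_comp_tensorHom]

theorem isAntipode_of_isSeparating {ι : Type v} {B : ι → SemiHopfCat V} (G : ∀ j, A ⟶ B j)
    (hG : ∀ x y : A.carrier, IsSeparating fun j =>
      onHom (G j) (rfl : onObj (G j) x = _) (rfl : onObj (G j) y = _))
    {S : ∀ j, ∀ a b : (B j).carrier, (a ⟶[V] b) ⟶ (b ⟶[V] a)} (hS : ∀ j, (B j).IsAntipode (S j))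
    {s : ∀ x y : A.carrier, (x ⟶[V] y) ⟶ (y ⟶[V] x)} (hsε : ∀ x y, s x y ≫ ε = ε)
    (hsΔ : ∀ x y, s x y ≫ Δ = Δ ≫ (β_ _ _).hom ≫ (s x y ⊗ₘ s x y))
    (hsG : ∀ j x y, s x y ≫ onHom (G j) rfl rfl = onHom (G j) rfl rfl ≫ S j _ _) :
    A.IsAntipode s := by
  refine isAntipode_iff.2 fun x y => ?_
  have inv (j : ι) : IsConvInverse (onHom (G j) (rfl : onObj (G j) x = _) (rfl : onObj (G j) y = _))
      (s x y ≫ onHom (G j) rfl rfl) := by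
    rw [hsG]
    exact (hS j).isConvInverse _
  constructor
  · refine hG x x _ _ (comp_comulList_eq ?_ (fun _ _ => conv_id_comul (hsΔ x y)) fun j => ?_)
    · rw [conv_counit (Category.id_comp _) (hsε x y), convUnit_counit]
    · rw [conv_onHom _ rfl rfl rfl, convUnit_onHom, Category.id_comp, (inv j).right]
  · refine hG y y _ _ (comp_comulList_eq ?_ (fun _ _ => conv_comul_id (hsΔ x y)) fun j => ?_)
    · rw [conv_counit (hsε x y) (Category.id_comp _), convUnit_counit]
    · rw [conv_onHom _ rfl rfl rfl, convUnit_onHom, Category.id_comp, (inv j).left]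

end

noncomputable section Limits

attribute [local instance] ComonObj.instTensorUnit

variable {J : Type v} [SmallCategory J] {F : J ⥤ SemiHopfCat V}

variable (F) in
/-- The limit of the sets of objects of a diagram of semi-Hopf categories. -/
@[ext]
structure LimObj : Type v where
  val : ∀ j, (F.obj j).carrier
  property : ∀ {j k : J} (f : j ⟶ k), onObj (F.map f) (val j) = val k

/-- The diagram of comonoids whose limit is the Hom-object of the limit from `x` to `y`. -/
abbrev homDiagram (x y : LimObj F) : J ⥤ Comon V where
  obj j := Comon.mk (x.val j ⟶[V] y.val j)
  map f := Comon.Hom.mk (onHom (F.map f) (x.property f) (y.property f))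
  map_id j := Comon.Hom.ext
    ((onHom_congr (F.map_id j) (x.property _) (y.property _)).trans
      (onHom_id_functor _ _ rfl rfl))
  map_comp f g := Comon.Hom.ext
    ((onHom_congr (F.map_comp f g) (x.property _) (y.property _)).trans
      (onHom_onHom (F.map f) (F.map g) (x.property f) (y.property f) (x.property g)
        (y.property g)).symm)

section

variable [HasLimitsOfShape J (Comon V)]

/-- The Hom-objects of the limit of a diagram of semi-Hopf categories. -/
abbrev limHom (x y : LimObj F) : V :=
  (limit (homDiagram x y)).X

/-- The projections of the Hom-objects of the limit. -/
abbrev limHomπ (x y : LimObj F) (j : J) :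
    limHom x y ⟶ (x.val j ⟶[V] y.val j) :=
  (limit.π (homDiagram x y) j).hom

theorem limHomπ_onHom (x y : LimObj F) {j k : J} (f : j ⟶ k) :
    limHomπ x y j ≫ onHom (F.map f) (x.property f) (y.property f) = limHomπ x y k :=
  congrArg Comon.Hom.hom (limit.w (homDiagram x y) f)

section HomLift

variable {x y : LimObj F} {D : V} [ComonObj D]

/-- The morphism of comonoids to a Hom-object of the limit induced by a cone. -/
def limHomLift (p : ∀ j, D ⟶ (x.val j ⟶[V] y.val j)) (hp : ∀ j, IsComonHom (p j))
    (w : ∀ (j k : J) (f : j ⟶ k),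
      p j ≫ onHom (F.map f) (x.property f) (y.property f) = p k) : D ⟶ limHom x y :=
  (limit.lift (homDiagram x y)
    { pt := Comon.mk D
      π :=
        { app := fun j =>
            haveI := hp j
            Comon.Hom.mk (p j)
          naturality := fun _ _ f =>
            (Category.id_comp _).trans (Comon.Hom.ext (w _ _ f).symm) } }).hom

section

variable (p : ∀ j, D ⟶ (x.val j ⟶[V] y.val j)) (hp : ∀ j, IsComonHom (p j))
  (w : ∀ (j k : J) (f : j ⟶ k), p j ≫ onHom (F.map f) (x.property f) (y.property f) = p k)

theorem limHomLift_isComonHom : IsComonHom (limHomLift p hp w) :=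
  Comon.Hom.isComonHom_hom _

theorem limHomLift_π (j : J) : limHomLift p hp w ≫ limHomπ x y j = p j := by
  have h := limit.lift_π (F := homDiagram x y)
    { pt := Comon.mk D
      π :=
        { app := fun j => Comon.Hom.mk (p j)
          naturality := fun _ _ f =>
            (Category.id_comp _).trans (Comon.Hom.ext (w _ _ f).symm) } } j
  exact congrArg Comon.Hom.hom h

end

theorem limHom_ext (f g : D ⟶ limHom x y) [IsComonHom f] [IsComonHom g]
    (h : ∀ j, f ≫ limHomπ x y j = g ≫ limHomπ x y j) : f = g := by
  have h' : (Comon.Hom.mk f : Comon.mk D ⟶ limit (homDiagram x y)) = Comon.Hom.mk g :=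
    limit.hom_ext (F := homDiagram x y) fun j => Comon.Hom.ext (h j)
  exact congrArg Comon.Hom.hom h'

end HomLift

/-- The composition of the limit. -/
def limComp (x y z : LimObj F) : limHom x y ⊗ limHom y z ⟶ limHom x z :=
  limHomLift (fun j => (limHomπ x y j ⊗ₘ limHomπ y z j) ≫ eComp V _ _ _) inferInstance
    fun _ _ f => by
    rw [Category.assoc, onHom_comp _ _ (y.property f), tensorHom_comp_tensorHom_assoc,
      limHomπ_onHom, limHomπ_onHom]

instance (x y z : LimObj F) : IsComonHom (limComp x y z) :=
  limHomLift_isComonHom _ _ _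

theorem limComp_π (x y z : LimObj F) (j : J) :
    limComp x y z ≫ limHomπ x z j = (limHomπ x y j ⊗ₘ limHomπ y z j) ≫ eComp V _ _ _ :=
  limHomLift_π _ _ _ j

/-- The identities of the limit. -/
def limId (x : LimObj F) : 𝟙_ V ⟶ limHom x x :=
  limHomLift (fun j => eId V (x.val j)) inferInstance fun _ _ _ => onHom_id _ _ _

instance (x : LimObj F) : IsComonHom (limId x) :=
  limHomLift_isComonHom _ _ _

theorem limId_π (x : LimObj F) (j : J) : limId x ≫ limHomπ x x j = eId V (x.val j) :=
  limHomLift_π _ _ _ j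

theorem limId_limComp (x y : LimObj F) :
    limId x ▷ limHom x y ≫ limComp x x y = (λ_ _).hom :=
  limHom_ext _ _ fun j => by
    rw [Category.assoc, limComp_π, ← tensorHom_id, tensorHom_comp_tensorHom_assoc, limId_π,
      Category.id_comp, eId_tensorHom_eComp]

theorem limComp_limId (x y : LimObj F) :
    limHom x y ◁ limId y ≫ limComp x y y = (ρ_ _).hom :=
  limHom_ext _ _ fun j => by
    rw [Category.assoc, limComp_π, ← id_tensorHom, tensorHom_comp_tensorHom_assoc, limId_π,
      Category.id_comp, tensorHom_eId_eComp]

theorem limComp_assoc (x y z t : LimObj F) :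
    (α_ _ _ _).inv ≫ limComp x y z ▷ limHom z t ≫ limComp x z t =
      limHom x y ◁ limComp y z t ≫ limComp x y t :=
  limHom_ext _ _ fun j => by
    simp only [Category.assoc, limComp_π]
    rw [← tensorHom_id, ← id_tensorHom, tensorHom_comp_tensorHom_assoc,
      tensorHom_comp_tensorHom_assoc, limComp_π, limComp_π, Category.id_comp, Category.id_comp,
      tensorHom_tensorHom_eComp]

variable (F) in
/-- The limit of a diagram of semi-Hopf categories. -/
def limCat : SemiHopfCat V where
  carrier := LimObj F
  enriched :=
    { Hom := limHom
      id := limId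
      comp := limComp
      id_comp := fun x y => by rw [limId_limComp, Iso.inv_hom_id]
      comp_id := fun x y => by rw [limComp_limId, Iso.inv_hom_id]
      assoc := limComp_assoc }
  comon x y := (limit (homDiagram x y)).comon
  comp_comul x y z := by
    have h := IsComonHom.hom_comul (limComp x y z)
    rw [Comon.tensorObj_comul, Category.assoc] at h
    exact h
  comp_counit x y z := IsComonHom.hom_counit (limComp x y z)
  id_comul x := IsComonHom.hom_comul (limId x)
  id_counit x := IsComonHom.hom_counit (limId x)

/-- The projections of the limit. -/
def limπ (j : J) : limCat F ⟶ F.obj j :=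
  show Hom (limCat F) (F.obj j) from
    { toFunctor :=
        { obj := fun x => x.val j
          map := fun x y => limHomπ x y j
          map_id := fun x => limId_π x j
          map_comp := fun x y z => limComp_π x y z j }
      isComonHom := fun x y => inferInstanceAs (IsComonHom (limHomπ x y j)) }

theorem onHom_limπ (x y : LimObj F) (j : J) :
    onHom (A := limCat F) (limπ j) (x := x) (y := y) rfl rfl = limHomπ x y j :=
  onHom_rfl (limπ j) x y

variable (F) in
/-- The limit cone of a diagram of semi-Hopf categories. -/
def limCone : Cone F where
  pt := limCat F
  π :=
    { app := limπ
      naturality := fun j k f => by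
        refine (Category.id_comp _).trans (hom_ext (A := limCat F) (B := F.obj k)
          (F := limπ j ≫ F.map f) (G := limπ k) (fun x => x.property f) fun x y => ?_).symm
        refine (onHom_onHom (limπ j) (F.map f) rfl rfl (x.property f) (y.property f)).symm.trans ?_
        refine (congrArg (· ≫ _) (onHom_limπ x y j)).trans ?_
        exact (limHomπ_onHom x y f).trans (onHom_limπ x y k).symm }

section Lift

variable (s : Cone F)

/-- The action on objects of the functor induced by a cone. -/
def liftObj (a : s.pt.carrier) : LimObj F :=
  ⟨fun j => onObj (s.π.app j) a, fun f => congrArg (fun G => onObj G a) (s.w f)⟩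

/-- The components of the functor induced by a cone. -/
def liftHom (a b : s.pt.carrier) :
    (a ⟶[V] b) ⟶ limHom (liftObj s a) (liftObj s b) :=
  limHomLift (fun j => onHom (s.π.app j) rfl rfl) (fun _ => onHom_isComonHom _ _ _)
    fun j _ f =>
    (onHom_onHom (s.π.app j) (F.map f) rfl rfl ((liftObj s a).property f)
      ((liftObj s b).property f)).trans (onHom_congr (s.w f) _ _)

instance (a b : s.pt.carrier) : IsComonHom (liftHom s a b) :=
  limHomLift_isComonHom _ _ _

theorem liftHom_π (a b : s.pt.carrier) (j : J) :
    liftHom s a b ≫ limHomπ _ _ j = onHom (s.π.app j) rfl rfl :=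
  limHomLift_π _ _ _ j

variable {s} in
theorem eq_liftHom {a b : s.pt.carrier} {p : (a ⟶[V] b) ⟶ limHom (liftObj s a) (liftObj s b)}
    (_ : IsComonHom p) (h : ∀ j, p ≫ limHomπ _ _ j = onHom (s.π.app j) rfl rfl) :
    p = liftHom s a b :=
  limHom_ext _ _ fun j => (h j).trans (liftHom_π s a b j).symm

theorem eId_liftHom (a : s.pt.carrier) : eId V a ≫ liftHom s a a = limId (liftObj s a) :=
  limHom_ext _ _ fun j => by
    rw [Category.assoc, liftHom_π, limId_π]
    exact onHom_id _ _ _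

theorem eComp_liftHom (a b c : s.pt.carrier) :
    eComp V a b c ≫ liftHom s a c =
      (liftHom s a b ⊗ₘ liftHom s b c) ≫ limComp (liftObj s a) (liftObj s b) (liftObj s c) :=
  limHom_ext _ _ fun j => by
    rw [Category.assoc, liftHom_π, Category.assoc, limComp_π, tensorHom_comp_tensorHom_assoc,
      liftHom_π, liftHom_π]
    exact onHom_comp _ _ _ _

/-- The functor induced by a cone. -/
def limLift : s.pt ⟶ limCat F :=
  show Hom s.pt (limCat F) from
    { toFunctor :=
        { obj := liftObj s
          map := liftHom s
          map_id := eId_liftHom s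
          map_comp := eComp_liftHom s }
      isComonHom := fun a b => inferInstanceAs (IsComonHom (liftHom s a b)) }

theorem limLift_limπ (j : J) : limLift s ≫ limπ j = s.π.app j :=
  hom_ext (A := s.pt) (B := F.obj j) (F := limLift s ≫ limπ j) (G := s.π.app j)
    (fun _ => rfl) fun a b => by
      refine (onHom_onHom (limLift s) (limπ j) rfl rfl rfl rfl).symm.trans ?_
      refine (congrArg (· ≫ _) (onHom_rfl (limLift s) a b)).trans ?_
      exact (congrArg (_ ≫ ·) (onHom_limπ _ _ j)).trans (liftHom_π s a b j)

theorem onHom_limHomπ {A : SemiHopfCat V} (m : A ⟶ limCat F) {a b : A.carrier} {x y : LimObj F}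
    (hx : onObj m a = x) (hy : onObj m b = y) (j : J) :
    onHom m hx hy ≫ limHomπ x y j =
      onHom (m ≫ limπ j) (congrArg (LimObj.val · j) hx) (congrArg (LimObj.val · j) hy) :=
  (congrArg (_ ≫ ·) (onHom_limπ x y j)).symm.trans (onHom_onHom m (limπ j) hx hy rfl rfl)

variable {s} in
theorem eq_limLift {m : s.pt ⟶ limCat F} (hm : ∀ j, m ≫ limπ j = s.π.app j) :
    m = limLift s := by
  have ho : ∀ a, onObj m a = liftObj s a := fun a =>
    LimObj.ext (funext fun j => congrArg (fun G => onObj G a) (hm j))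
  refine hom_ext (A := s.pt) (B := limCat F) (F := m) (G := limLift s) ho fun a b => ?_
  have h : onHom m (ho a) (ho b) = liftHom s a b :=
    eq_liftHom (onHom_isComonHom m (ho a) (ho b)) fun j =>
      (onHom_limHomπ m (ho a) (ho b) j).trans (onHom_congr (hm j) _ _)
  exact h.trans (onHom_rfl (limLift s) a b).symm

end Lift

variable (F) in
/-- The universal property of the limit cone of a diagram of semi-Hopf categories. -/
def limConeIsLimit : IsLimit (limCone F) where
  lift := limLift
  fac := limLift_limπ
  uniq _ _ := eq_limLift

variable (V J) in
theorem hasLimitsOfShape : HasLimitsOfShape J (SemiHopfCat V) :=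
  ⟨fun F => ⟨⟨⟨limCone F, limConeIsLimit F⟩⟩⟩⟩

theorem exists_limAntipode {S : ∀ j, ∀ a b : (F.obj j).carrier, (a ⟶[V] b) ⟶ (b ⟶[V] a)}
    (hS : ∀ j, (F.obj j).IsAntipode (S j)) (x y : LimObj F) :
    ∃ s : limHom x y ⟶ limHom y x, s ≫ ε = ε ∧ s ≫ Δ = Δ ≫ (β_ _ _).hom ≫ (s ⊗ₘ s) ∧
      ∀ j, s ≫ limHomπ y x j = limHomπ x y j ≫ S j (x.val j) (y.val j) := by
  have hp (j : J) := isComonHom_copComon (limHomπ x y j ≫ S j (x.val j) (y.val j))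
    (by rw [Category.assoc, (hS j).comp_counit, IsComonHom.hom_counit])
    (by rw [Category.assoc, (hS j).comp_comul, IsComonHom.hom_comul_assoc,
      BraidedCategory.braiding_naturality_assoc, tensorHom_comp_tensorHom])
  have w (j k : J) (f : j ⟶ k) := calc
    (limHomπ x y j ≫ S j (x.val j) (y.val j)) ≫ onHom (F.map f) (y.property f) (x.property f)
    _ = limHomπ x y k ≫ S k (x.val k) (y.val k) := by
      rw [Category.assoc, (hS j).comp_onHom (hS k), reassoc_of% limHomπ_onHom x y f]
  let cop := copComon (limHom x y)
  have h := @limHomLift_isComonHom V _ _ _ J _ F _ y x _ cop _ hp w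
  exact ⟨_, h.hom_counit, h.hom_comul.trans (Category.assoc _ _ _),
    @limHomLift_π V _ _ _ J _ F _ y x _ cop _ hp w⟩

end

variable [HasLimits V] [HasColimits V] [WellPowered.{v} V]

theorem isSeparating_onHom_limπ [HasLimitsOfShape J (Comon V)] (hV : VeryFlatTensor V)
    (x y : (limCat F).carrier) :
    IsSeparating fun j => onHom (limπ j) (rfl : onObj (limπ j) x = _)
      (rfl : onObj (limπ j) y = _) := by
  have h : IsSeparating (limHomπ x y) :=
    isSeparating_of_isLimit hV (limit.isLimit (homDiagram x y))
  rw [← funext (onHom_limπ x y)] at h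
  exact h

theorem isHopf_limCat [HasLimitsOfShape J (Comon V)] (hV : VeryFlatTensor V)
    (hF : ∀ j, isHopf V (F.obj j)) : isHopf V (limCat F) := by
  choose S hS using hF
  choose s hsε hsΔ hsπ using exists_limAntipode hS
  refine ⟨s, isAntipode_of_isSeparating limπ (isSeparating_onHom_limπ hV) hS hsε hsΔ
    fun j x y => ?_⟩
  refine (congrArg (s x y ≫ ·) (onHom_limπ y x j)).trans ((hsπ x y j).trans ?_)
  exact congrArg (· ≫ S j _ _) (onHom_limπ x y j).symm

theorem isHopf_isClosedUnderLimitsOfShape (hV : VeryFlatTensor V) (J : Type v) [SmallCategory J] :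
    (isHopf V).IsClosedUnderLimitsOfShape J where
  limitsOfShape_le := by
    rintro X ⟨p⟩
    have := hasLimitsOfShape_comon (J := J) hV
    exact (isHopf V).prop_of_iso ((limConeIsLimit p.diag).conePointUniqueUpToIso p.isLimit)
      (isHopf_limCat hV p.prop_diag_obj)

theorem hasLimits (hV : VeryFlatTensor V) : HasLimits (SemiHopfCat V) where
  has_limits_of_shape J _ :=
    have := hasLimitsOfShape_comon (J := J) hV
    hasLimitsOfShape V J

end Limits

end SemiHopfCat

theorem proposition3p4_general (V : Type u) [Category.{v} V] [MonoidalCategory V]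
    [BraidedCategory V] [HasColimits V] :
    ((∀ A : V, PreservesColimits (tensorLeft A)) →
      HasColimits (HopfCat V) ∧
      PreservesColimits (isHopf V).ι ∧
      ∀ (J : Type v) [SmallCategory J], (isHopf V).IsClosedUnderColimitsOfShape J) ∧
    (∀ [HasLimits V] [WellPowered.{v} V], VeryFlatTensor V →
      HasLimits (HopfCat V) ∧
      PreservesLimits (isHopf V).ι ∧
      ∀ (J : Type v) [SmallCategory J], (isHopf V).IsClosedUnderLimitsOfShape J) := by
  refine ⟨fun _ => ?_, fun hV => ?_⟩
  · have := SemiHopfCat.hasColimits (V := V)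
    have closed (J : Type v) [SmallCategory J] : (isHopf V).IsClosedUnderColimitsOfShape J :=
      SemiHopfCat.isHopf_isClosedUnderColimitsOfShape J
    exact ⟨⟨fun J _ => inferInstance⟩, ⟨fun {J} _ => inferInstance⟩, closed⟩
  · have := SemiHopfCat.hasLimits hV
    have closed (J : Type v) [SmallCategory J] : (isHopf V).IsClosedUnderLimitsOfShape J :=
      SemiHopfCat.isHopf_isClosedUnderLimitsOfShape hV J
    exact ⟨⟨fun J _ => inferInstance⟩, ⟨fun {J} _ => inferInstance⟩, closed⟩

theorem proposition3p4 (V : Type u) [Category.{v} V] [MonoidalCategory V] [SymmetricCategory V]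
    [IsLocallyPresentable.{v} V] :
    (∀ [MonoidalClosed V],
      HasColimits (HopfCat V) ∧
      PreservesColimits (isHopf V).ι ∧
      ∀ (J : Type v) [SmallCategory J], (isHopf V).IsClosedUnderColimitsOfShape J) ∧
    (VeryFlatTensor V →
      HasLimits (HopfCat V) ∧
      PreservesLimits (isHopf V).ι ∧
      ∀ (J : Type v) [SmallCategory J], (isHopf V).IsClosedUnderLimitsOfShape J) := by
  have := hasColimits_of_isLocallyPresentable V
  have := hasLimits_of_isLocallyPresentable V
  have := wellPowered_of_isLocallyPresentable V
  exact ⟨(proposition3p4_general V).1 fun _ => inferInstance, (proposition3p4_general V).2⟩
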